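/- **Definitions.** A literal is a propositional variable or its negation; $\bar a$ is the dual of the literal $a$. Formulae are built from literals and the units $\top,\bot$ with $\wedge,\vee$, and $\bar A$ is the De Morgan dual of $A$. *The system $\mathsf{KS}$* has the inference rules (premiss $\to$ conclusion): $\top\to a\vee\bar a$ (identity), $\bot\to a$ (weakening), $a\vee a\to a$ (contraction) for literals $a$; $A\wedge(B\vee C)\to(A\wedge B)\vee C$ (switch) and $(A\wedge B)\vee(C\wedge D)\to(A\vee C)\wedge(B\vee D)$ (medial) for formulae $A,B,C,D$; and $A\to B$ whenever $A=B$, where $=$ is the congruence generated by commutativity and associativity of $\wedge$ and $\vee$ and by $A\vee\bot=A$, $A\wedge\top=A$, $\top\vee\top=\top$, $\bot\wedge\bot=\bot$. Derivations, with their premisses and conclusions, are generated as follows: every formula is a derivation from itself to itself; if $\Phi$ and $\Psi$ are derivations, so are $\Phi\wedge\Psi$ and $\Phi\vee\Psi$, whose premisses and conclusions are formed componentwise; and if the step from the conclusion of $\Phi$ to the premiss of $\Psi$ is an instance of a rule, then $\Phi$ followed by $\Psi$ is a derivation from the premiss of $\Phi$ to the conclusion of $\Psi$. A $\mathsf{KS}$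 proof of $A$ is a derivation with premiss $\top$ and conclusion $A$. *Multiset Resolution.* Let $\Gamma_1,\dots,\Gamma_s$ be finite multisets of literals. A derivation from them is a list $\pi=(\Delta_1,\dots,\Delta_n)$ of finite multisets of literals in which each $\Delta_i$ is some $\Gamma_j$ or follows from earlier entries by weakening, from $\Gamma$ infer $\Gamma\cup\Delta$, or by resolution, from $\Gamma\cup\{a\}$ and $\Delta\cup\{\bar a\}$ infer $\Gamma\cup\Delta$; here $\cup$ is the additive union of multisets. An entry may be used as a premiss any number of times, so derivations are dag-like. The list $\pi$ is a refutation of $\Gamma_1,\dots,\Gamma_s$ if $n\ge 1$ and $\Delta_n=\emptyset$. **Theorem.** $\mathsf{KS}$ polynomially simulates multiset Resolution. That is, there is a polynomial-time algorithm that transforms every refutation $\pi$ of multisets $\Gamma_1,\dots,\Gamma_s$ in multiset Resolution (given with $\Gamma_1,\dots,\Gamma_s$) into a $\mathsf{KS}$ proof of $$\overline{\bigwedge_{r=1}^{s}\bigvee\Gamma_r}\;=\;\bigvee_{r=1}^{s}\overline{\Gamma_r},\qquad\text{where }\overline{\Gamma_r}=\bigwedge_{a\in\Gamma_r}\bar a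 .$$ The running time is that of a Turing machine, and is polynomial in the length of $\pi$ and $\Gamma_1,\dots,\Gamma_s$ written as a string. -/

import Mathlib

namespace KSSim

/-- Literals (called atoms in deep inference): a propositional variable, indexed by a natural
number, together with a polarity. -/
structure Lit where
  var : ℕ
  pos : Bool
deriving DecidableEq

/-- The dual literal. -/
def Lit.dual (a : Lit) : Lit := ⟨a.var, !a.pos⟩

/-- Propositional formulae in negation normal form over the basis `⊤, ⊥, ∧, ∨`. -/
inductive Formula where
  | top : Formula
  | bot : Formula
  | lit (a : Lit) : Formula
  | and (A B : Formula) : Formula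
  | or (A B : Formula) : Formula
deriving DecidableEq

namespace Formula

/-- The De Morgan dual of a formula. -/
def dual : Formula → Formula
  | top => bot
  | bot => top
  | lit a => lit a.dual
  | and A B => or A.dual B.dual
  | or A B => and A.dual B.dual

/-- The disjunction of a list of formulae; the empty disjunction is `⊥`. -/
def bigOr : List Formula → Formula
  | [] => bot
  | [A] => A
  | A :: B :: l => or A (bigOr (B :: l))

/-- The conjunction of a list of formulae; the empty conjunction is `⊤`. -/
def bigAnd : List Formula → Formula
  | [] => top
  | [A] => A
  | A :: B :: l => and A (bigAnd (B :: l))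

/-- The congruence on formulae that underlies the logical rule `=`. -/
inductive Eqv : Formula → Formula → Prop
  | refl (A : Formula) : Eqv A A
  | symm {A B : Formula} : Eqv A B → Eqv B A
  | trans {A B C : Formula} : Eqv A B → Eqv B C → Eqv A C
  | or_comm (A B : Formula) : Eqv (or A B) (or B A)
  | and_comm (A B : Formula) : Eqv (and A B) (and B A)
  | or_assoc (A B C : Formula) : Eqv (or (or A B) C) (or A (or B C))
  | and_assoc (A B C : Formula) : Eqv (and (and A B) C) (and A (and B C))
  | or_bot (A : Formula) : Eqv (or A bot) A
  | and_top (A : Formula) : Eqv (and A top) A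
  | top_or_top : Eqv (or top top) top
  | bot_and_bot : Eqv (and bot bot) bot
  | or_ctx {A B : Formula} (C : Formula) : Eqv A B → Eqv (or C A) (or C B)
  | and_ctx {A B : Formula} (C : Formula) : Eqv A B → Eqv (and C A) (and C B)

end Formula

/-- The rules of `KS`: the logical rule `=`, which belongs to every system, atomic identity `ai↓`,
atomic weakening `aw↓`, atomic contraction `ac↓`, switch `s` and medial `m`. -/
inductive Rule where
  | eq | aid | awd | acd | swi | med
deriving DecidableEq

instance : Fintype Rule :=
  ⟨{.eq, .aid, .awd, .acd, .swi, .med}, fun ρ => by cases ρ <;> decide⟩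

open Formula in
/-- `RuleInst ρ A B`: the inference with premiss `A` and conclusion `B` is an instance of `ρ`. -/
inductive RuleInst : Rule → Formula → Formula → Prop
  | eq {A B : Formula} : Eqv A B → RuleInst .eq A B
  | aid (a : Lit) : RuleInst .aid top (or (lit a) (lit a.dual))
  | awd (a : Lit) : RuleInst .awd bot (lit a)
  | acd (a : Lit) : RuleInst .acd (or (lit a) (lit a)) (lit a)
  | swi (A B C : Formula) : RuleInst .swi (and A (or B C)) (or (and A B) C)
  | med (A B C D : Formula) :
      RuleInst .med (or (and A B) (and C D)) (and (or A C) (or B D))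

/-- Derivation expressions: formulae, the composition of two derivations by a connective, and the
vertical composition `step ρ Φ Ψ` of `Φ` (above) with `Ψ` (below) by an inference labelled `ρ`. -/
inductive Deriv where
  | fm (A : Formula) : Deriv
  | and (Φ Ψ : Deriv) : Deriv
  | or (Φ Ψ : Deriv) : Deriv
  | step (ρ : Rule) (Φ Ψ : Deriv) : Deriv
deriving DecidableEq

namespace Deriv

/-- The premiss of a derivation. -/
def pr : Deriv → Formula
  | fm A => A
  | and Φ Ψ => Formula.and Φ.pr Ψ.pr
  | or Φ Ψ => Formula.or Φ.pr Ψ.pr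
  | step _ Φ _ => Φ.pr

/-- The conclusion of a derivation. -/
def cn : Deriv → Formula
  | fm A => A
  | and Φ Ψ => Formula.and Φ.cn Ψ.cn
  | or Φ Ψ => Formula.or Φ.cn Ψ.cn
  | step _ _ Ψ => Ψ.cn

/-- The derivation expression is a `KS` derivation: every vertical composition is by an instance
of the rule it is labelled with. -/
def Valid : Deriv → Prop
  | fm _ => True
  | and Φ Ψ => Φ.Valid ∧ Ψ.Valid
  | or Φ Ψ => Φ.Valid ∧ Ψ.Valid
  | step ρ Φ Ψ => Φ.Valid ∧ Ψ.Valid ∧ RuleInst ρ Φ.cn Ψ.pr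

/-- `Φ` is a `KS` proof of `A`: a `KS` derivation with premiss `⊤` and conclusion `A`. -/
def IsKSProof (Φ : Deriv) (A : Formula) : Prop :=
  Φ.Valid ∧ Φ.pr = Formula.top ∧ Φ.cn = A

end Deriv

/-- Multiset Resolution: `ResDerivation Γ π` says that the list `π` of multisets of literals is a
derivation from the multisets in `Γ`. Each new line is a member of `Γ` or follows from earlier
lines, which may be reused arbitrarily often, by weakening or resolution. Multiset union is
additive. -/
inductive ResDerivation (Γ : List (Multiset Lit)) : List (Multiset Lit) → Prop
  | nil : ResDerivation Γ []
  | init {π : List (Multiset Lit)} {C : Multiset Lit} :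
      ResDerivation Γ π → C ∈ Γ → ResDerivation Γ (π ++ [C])
  | wk {π : List (Multiset Lit)} {C : Multiset Lit} (D : Multiset Lit) :
      ResDerivation Γ π → C ∈ π → ResDerivation Γ (π ++ [C + D])
  | res {π : List (Multiset Lit)} {C D : Multiset Lit} (a : Lit) :
      ResDerivation Γ π → C + {a} ∈ π → D + {a.dual} ∈ π → ResDerivation Γ (π ++ [C + D])

/-- A refutation is a derivation whose last line is the empty multiset. -/
def IsRefutation (Γ π : List (Multiset Lit)) : Prop :=
  ResDerivation Γ π ∧ π.getLast? = some 0

/-- A written clause: the literals of a multiset, with repetitions, listed in some order. -/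
abbrev Clause := List Lit

/-- The multisets of literals denoted by a list of written clauses. -/
def toMultisets (Γ : List Clause) : List (Multiset Lit) :=
  Γ.map fun C => (C : Multiset Lit)

/-- The formula denoted by a list of clauses: the conjunction of the disjunctions of literals. -/
def cnf (Γ : List Clause) : Formula :=
  Formula.bigAnd (Γ.map fun C => Formula.bigOr (C.map Formula.lit))

/-- The alphabet in which refutations and derivations are written as strings. -/
inductive Sym where
  | bit (b : Bool)
  | sign (b : Bool)
  | endLit | endClause | endList
  | top | bot | lit | and | or
  | fm
  | rule (ρ : Rule)
deriving DecidableEq, Fintype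

/-- A literal is written as its polarity, its variable in binary, and an end marker. -/
def encodeLit (a : Lit) : List Sym :=
  Sym.sign a.pos :: ((Computability.encodeNat a.var).map Sym.bit ++ [Sym.endLit])

/-- The string of a list of clauses. -/
def encodeClauses (Γ : List Clause) : List Sym :=
  Γ.flatMap (fun C => C.flatMap encodeLit ++ [Sym.endClause]) ++ [Sym.endList]

/-- The string of a pair consisting of a list of premisses and the lines of a derivation. -/
def encodeInput (x : List Clause × List Clause) : List Sym :=
  encodeClauses x.1 ++ encodeClauses x.2

/-- Formulae are written in prefix notation. -/
def encodeFormula : Formula → List Sym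
  | .top => [.top]
  | .bot => [.bot]
  | .lit a => .lit :: encodeLit a
  | .and A B => .and :: (encodeFormula A ++ encodeFormula B)
  | .or A B => .or :: (encodeFormula A ++ encodeFormula B)

/-- Derivations are written in prefix notation, each inference step with its rule label. -/
def encodeDeriv : Deriv → List Sym
  | .fm A => .fm :: encodeFormula A
  | .and Φ Ψ => .and :: (encodeDeriv Φ ++ encodeDeriv Ψ)
  | .or Φ Ψ => .or :: (encodeDeriv Φ ++ encodeDeriv Ψ)
  | .step ρ Φ Ψ => .rule ρ :: (encodeDeriv Φ ++ encodeDeriv Ψ)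

/-- The encodings are unambiguous. -/
theorem encodeLit_prefix {a b : Lit} {s t : List Sym}
    (h : encodeLit a ++ s = encodeLit b ++ t) : a = b ∧ s = t := by
  have key : ∀ l m : List Bool,
      l.map Sym.bit ++ (Sym.endLit :: s) = m.map Sym.bit ++ (Sym.endLit :: t) →
        l = m ∧ s = t := by
    intro l
    induction l with
    | nil => intro m; cases m <;> simp
    | cons x l ih =>
      intro m
      cases m with
      | nil => simp
      | cons y m =>
        intro h
        simp only [List.map_cons, List.cons_append, List.cons.injEq, Sym.bit.injEq] at h
        obtain ⟨h1, h2⟩ := ih m h.2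
        exact ⟨by rw [h.1, h1], h2⟩
  obtain ⟨v, p⟩ := a
  obtain ⟨w, q⟩ := b
  simp only [encodeLit, List.cons_append, List.append_assoc, List.nil_append, List.cons.injEq,
    Sym.sign.injEq] at h
  obtain ⟨h1, h2⟩ := key _ _ h.2
  have h3 : v = w := by
    rw [← Computability.decode_encodeNat v, h1, Computability.decode_encodeNat w]
  exact ⟨by rw [h.1, h3], h2⟩

theorem encodeClause_prefix {C D : Clause} {s t : List Sym}
    (h : C.flatMap encodeLit ++ (Sym.endClause :: s) =
      D.flatMap encodeLit ++ (Sym.endClause :: t)) : C = D ∧ s = t := by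
  induction C generalizing D with
  | nil => cases D <;> simp_all [encodeLit]
  | cons a C ih =>
    cases D with
    | nil => simp [encodeLit] at h
    | cons b D =>
      simp only [List.flatMap_cons, List.append_assoc] at h
      obtain ⟨h1, h2⟩ := encodeLit_prefix h
      obtain ⟨h3, h4⟩ := ih h2
      exact ⟨by rw [h1, h3], h4⟩

theorem encodeClauses_prefix {Γ Δ : List Clause} {s t : List Sym}
    (h : encodeClauses Γ ++ s = encodeClauses Δ ++ t) : Γ = Δ ∧ s = t := by
  have hne : ∀ (C : Clause) (u v : List Sym),
      C.flatMap encodeLit ++ (Sym.endClause :: u) ≠ Sym.endList :: v := by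
    intro C u v
    cases C <;> simp [encodeLit]
  simp only [encodeClauses, List.append_assoc, List.cons_append, List.nil_append] at h
  induction Γ generalizing Δ with
  | nil =>
    cases Δ with
    | nil => simpa using h
    | cons D Δ =>
      simp only [List.flatMap_nil, List.flatMap_cons, List.nil_append, List.append_assoc,
        List.cons_append] at h
      exact absurd h.symm (hne _ _ _)
  | cons C Γ ih =>
    cases Δ with
    | nil =>
      simp only [List.flatMap_nil, List.flatMap_cons, List.nil_append, List.append_assoc,
        List.cons_append] at h
      exact absurd h (hne _ _ _)
    | cons D Δ =>
      simp only [List.flatMap_cons, List.append_assoc, List.cons_append, List.nil_append] at h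
      obtain ⟨h1, h2⟩ := encodeClause_prefix h
      obtain ⟨h3, h4⟩ := ih h2
      exact ⟨by rw [h1, h3], h4⟩

theorem encodeInput_injective : Function.Injective encodeInput := by
  rintro ⟨Γ, π⟩ ⟨Γ', π'⟩ h
  obtain ⟨h1, h2⟩ := encodeClauses_prefix h
  have h3 := encodeClauses_prefix (s := []) (t := []) (by simpa using h2)
  exact Prod.ext h1 h3.1

theorem encodeFormula_prefix {A B : Formula} {s t : List Sym}
    (h : encodeFormula A ++ s = encodeFormula B ++ t) : A = B ∧ s = t := by
  induction A generalizing B s t with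
  | top => cases B <;> simp_all [encodeFormula]
  | bot => cases B <;> simp_all [encodeFormula]
  | lit a =>
    cases B <;> simp only [encodeFormula, List.cons_append, List.cons.injEq, reduceCtorEq,
      false_and, true_and, List.nil_append] at h
    obtain ⟨h1, h2⟩ := encodeLit_prefix h
    exact ⟨by rw [h1], h2⟩
  | and A A' ih ih' =>
    cases B <;> simp only [encodeFormula, List.cons_append, List.cons.injEq, reduceCtorEq,
      false_and, true_and, List.nil_append, List.append_assoc] at h
    obtain ⟨h1, h2⟩ := ih h
    obtain ⟨h3, h4⟩ := ih' h2
    exact ⟨by rw [h1, h3], h4⟩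
  | or A A' ih ih' =>
    cases B <;> simp only [encodeFormula, List.cons_append, List.cons.injEq, reduceCtorEq,
      false_and, true_and, List.nil_append, List.append_assoc] at h
    obtain ⟨h1, h2⟩ := ih h
    obtain ⟨h3, h4⟩ := ih' h2
    exact ⟨by rw [h1, h3], h4⟩

theorem encodeDeriv_prefix {Φ Ψ : Deriv} {s t : List Sym}
    (h : encodeDeriv Φ ++ s = encodeDeriv Ψ ++ t) : Φ = Ψ ∧ s = t := by
  induction Φ generalizing Ψ s t with
  | fm A =>
    cases Ψ <;> simp only [encodeDeriv, List.cons_append, List.cons.injEq, reduceCtorEq,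
      false_and, true_and] at h
    obtain ⟨h1, h2⟩ := encodeFormula_prefix h
    exact ⟨by rw [h1], h2⟩
  | and Φ Φ' ih ih' =>
    cases Ψ <;> simp only [encodeDeriv, List.cons_append, List.cons.injEq, reduceCtorEq,
      false_and, true_and, List.append_assoc] at h
    obtain ⟨h1, h2⟩ := ih h
    obtain ⟨h3, h4⟩ := ih' h2
    exact ⟨by rw [h1, h3], h4⟩
  | or Φ Φ' ih ih' =>
    cases Ψ <;> simp only [encodeDeriv, List.cons_append, List.cons.injEq, reduceCtorEq,
      false_and, true_and, List.append_assoc] at h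
    obtain ⟨h1, h2⟩ := ih h
    obtain ⟨h3, h4⟩ := ih' h2
    exact ⟨by rw [h1, h3], h4⟩
  | step ρ Φ Φ' ih ih' =>
    cases Ψ <;> simp only [encodeDeriv, List.cons_append, List.cons.injEq, reduceCtorEq,
      false_and, Sym.rule.injEq, List.append_assoc] at h
    obtain ⟨h0, h⟩ := h
    obtain ⟨h1, h2⟩ := ih h
    obtain ⟨h3, h4⟩ := ih' h2
    exact ⟨by rw [h0, h1, h3], h4⟩

theorem encodeDeriv_injective : Function.Injective encodeDeriv := by
  intro Φ Ψ h
  exact (encodeDeriv_prefix (s := []) (t := []) (by rw [h])).1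

end KSSim

open KSSim

/-! The resolvent of $C\cup\{a\}$ and $D\cup\{\bar a\}$ has $|C|+|D|$ elements, because union is
additive. It is shorter than one of its premisses only if the other one is a unit clause. The empty
clause is therefore out of reach without unit resolutions, and every refutable list of clauses is
refuted by unit propagation. The given refutation only witnesses this; the algorithm discards it and
works on the clauses alone.

Completeness of unit propagation (`nil_mem_unitProp`) rests on an invariant. Given a set $U$ of
literals, strike from each clause the literals whose duals lie in $U$, and count the rest with
multiplicity. A clause is stable if something is left and a single remaining literal lies in $U$.
Weakening and resolution preserve stability (`Stable.add`, `Stable.resolvent`), and the empty clause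
is not stable. If propagation never meets the empty clause, its run read backwards yields a $U$ that
makes all input clauses stable (`exists_stable`).

For the simulation (`unitDeriv_isKSProof`), a list of clauses stands for the disjunction of the
conjunctions of dual literals, and the derivation grows upwards from its conclusion. Let $\bar c$ be
the conjunction of the duals of $c$. Resolving the unit $\bar u$ with the clause $c\cup\{u\}$
becomes $u\vee\bar c = u\vee(\bar c\wedge\top)\to u\vee(\bar c\wedge(\bar u\vee u))\to u\vee(\bar
c\wedge\bar u)\vee u\to(\bar c\wedge\bar u)\vee u$ by identity, switch and contraction; contraction
is what permits the unit to be used again. A unit without a partner comes from weakening, and so do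
all literals left at the end, where the empty clause supplies $\top$.

For the running time (`exec_unitProg`), structured stack programs are compiled to a Turing machine.
Derivations are written in prefix notation and grow upwards as `step ρ Φ D`, so a round of
propagation only pushes a string on the output stack. A round takes linear time and removes one
literal occurrence, so the total time is quadratic. -/

namespace KSSim

/-! ### Structured stack programs and their compilation to Turing machines. -/

open Turing StateTransition Function

/-- Structured programs over stacks indexed by `K` with symbols in `Γ`. The program `loop k p c`
pops the stack `k`, runs `p x` for the result `x` of the pop, and repeats this as long as
`c x` holds. -/
inductive Prog (K Γ : Type) where
  | skip : Prog K Γ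
  | push (k : K) (x : Γ) : Prog K Γ
  | seq (p q : Prog K Γ) : Prog K Γ
  | loop (k : K) (p : Option Γ → Prog K Γ) (c : Option Γ → Bool) : Prog K Γ

/-- `Exec p s s' n`: the program `p` takes the stacks `s` to `s'` within `n` steps. -/
inductive Exec {K Γ : Type} [DecidableEq K] :
    Prog K Γ → (K → List Γ) → (K → List Γ) → ℕ → Prop
  | skip (s : K → List Γ) : Exec .skip s s 1
  | push (k : K) (x : Γ) (s : K → List Γ) : Exec (.push k x) s (update s k (x :: s k)) 1
  | seq {p q : Prog K Γ} {s s' s'' : K → List Γ} {m n : ℕ} :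
      Exec p s s' m → Exec q s' s'' n → Exec (.seq p q) s s'' (m + n)
  | loop_exit {k : K} {p : Option Γ → Prog K Γ} {c : Option Γ → Bool} {s s' : K → List Γ} {m : ℕ} :
      c (s k).head? = false → Exec (p (s k).head?) (update s k (s k).tail) s' m →
        Exec (.loop k p c) s s' (m + 1)
  | loop_next {k : K} {p : Option Γ → Prog K Γ} {c : Option Γ → Bool} {s s' s'' : K → List Γ}
      {m n : ℕ} :
      c (s k).head? = true → Exec (p (s k).head?) (update s k (s k).tail) s' m →
        Exec (.loop k p c) s' s'' n → Exec (.loop k p c) s s'' (m + n + 1)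
  | mono {p : Prog K Γ} {s s' : K → List Γ} {m n : ℕ} : Exec p s s' m → m ≤ n → Exec p s s' n

namespace Prog

variable {K Γ : Type}

/-- The control points of a program. -/
def Lab : Prog K Γ → Type
  | skip => Unit
  | push _ _ => Unit
  | seq p q => p.Lab ⊕ q.Lab
  | loop _ p _ => Unit ⊕ (Σ x : Option Γ, (p x).Lab)

instance instFintypeLab [Fintype Γ] : ∀ p : Prog K Γ, Fintype p.Lab
  | skip => inferInstanceAs (Fintype Unit)
  | push _ _ => inferInstanceAs (Fintype Unit)
  | seq p q =>
    letI := instFintypeLab p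
    letI := instFintypeLab q
    inferInstanceAs (Fintype (p.Lab ⊕ q.Lab))
  | loop _ p _ =>
    letI := fun x => instFintypeLab (p x)
    inferInstanceAs (Fintype (Unit ⊕ (Σ x : Option Γ, (p x).Lab)))

/-- The control point at which a program starts. -/
def entry : ∀ p : Prog K Γ, p.Lab
  | skip => ()
  | push _ _ => ()
  | seq p _ => Sum.inl p.entry
  | loop _ _ _ => Sum.inl ()

/-- The statements of a stack machine that runs a program placed at the labels `emb` and
leaves it for the label `exit`. The local variable of the machine is the last popped symbol. -/
def code {L : Type} : ∀ p : Prog K Γ, (p.Lab → L) → L → p.Lab →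
    TM2.Stmt (fun _ : K => Γ) L (Option Γ)
  | skip, _, exit => fun _ => .goto fun _ => exit
  | push k x, _, exit => fun _ => .push k (fun _ => x) (.goto fun _ => exit)
  | seq p q, emb, exit => Sum.elim
      (p.code (fun l => emb (Sum.inl l)) (emb (Sum.inr q.entry)))
      (q.code (fun l => emb (Sum.inr l)) exit)
  | loop k p c, emb, exit => Sum.elim
      -- The popped symbol is kept in the label. It thus outlives later pops in the body, and the
      -- exit test `c l.1` is decided at compile time.
      (fun _ => .pop k (fun _ x => x) (.goto fun x => emb (Sum.inr ⟨x, (p x).entry⟩)))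
      (fun l => (p l.1).code (fun l' => emb (Sum.inr ⟨l.1, l'⟩))
        (if c l.1 then emb (Sum.inl ()) else exit) l.2)

def evalsTo_loop_pop [DecidableEq K] {L : Type}
    (M : L → TM2.Stmt (fun _ : K => Γ) L (Option Γ)) {l : L} {k : K} {g : Option Γ → L}
    (h : M l = .pop k (fun _ x => x) (.goto g)) (v : Option Γ) (s : K → List Γ) :
    EvalsToInTime (TM2.step M) ⟨some l, v, s⟩
      (some ⟨some (g (s k).head?), (s k).head?, update s k (s k).tail⟩) 1 := by
  refine ⟨⟨1, ?_⟩, le_rfl⟩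
  simp [flip, h]

/-- Correctness of the compilation. The embedding of the labels and the exit are arbitrary, so that
the induction applies to subprograms in place. The local variable carries no information between
statements: any initial value is allowed and some final value results. -/
theorem evalsTo_of_exec [DecidableEq K] {L : Type} (M : L → TM2.Stmt (fun _ : K => Γ) L (Option Γ))
    {p : Prog K Γ} {s s' : K → List Γ} {n : ℕ} (h : Exec p s s' n) :
    ∀ (emb : p.Lab → L) (exit : L), (∀ l, M (emb l) = p.code emb exit l) → ∀ v, ∃ v',
      Nonempty (EvalsToInTime (TM2.step M) ⟨some (emb p.entry), v, s⟩
        (some ⟨some exit, v', s'⟩) n) := by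
  induction h with
  | skip s =>
    intro emb exit hM v
    refine ⟨v, ⟨⟨⟨1, ?_⟩, le_rfl⟩⟩⟩
    simp [flip, hM, code]
  | push k x s =>
    intro emb exit hM v
    refine ⟨v, ⟨⟨⟨1, ?_⟩, le_rfl⟩⟩⟩
    simp [flip, hM, code]
  | @seq p q s s' s'' m n _ _ ih1 ih2 =>
    intro emb exit hM v
    obtain ⟨v1, ⟨h1⟩⟩ := ih1 (fun l => emb (Sum.inl l)) (emb (Sum.inr q.entry))
      (fun l => hM (Sum.inl l)) v
    obtain ⟨v2, ⟨h2⟩⟩ := ih2 (fun l => emb (Sum.inr l)) exit (fun l => hM (Sum.inr l)) v1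
    refine ⟨v2, ⟨?_⟩⟩
    rw [Nat.add_comm]
    exact EvalsToInTime.trans _ _ _ _ _ _ h1 h2
  | @loop_exit k p c s s' m hc _ ih =>
    intro emb exit hM v
    obtain ⟨v1, ⟨h1⟩⟩ := ih (fun l' => emb (Sum.inr ⟨_, l'⟩)) exit
      (fun l => (hM (Sum.inr ⟨_, l⟩)).trans (by simp [code, hc])) (s k).head?
    exact ⟨v1, ⟨EvalsToInTime.trans _ 1 _ _ _ _
      (evalsTo_loop_pop M (hM (Sum.inl ())) v s) h1⟩⟩
  | @loop_next k p c s s' s'' m n hc _ _ ih1 ih2 =>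
    intro emb exit hM v
    obtain ⟨v1, ⟨h1⟩⟩ := ih1 (fun l' => emb (Sum.inr ⟨_, l'⟩)) (emb (Sum.inl ()))
      (fun l => (hM (Sum.inr ⟨_, l⟩)).trans (by simp [code, hc])) (s k).head?
    obtain ⟨v2, ⟨h2⟩⟩ := ih2 emb exit hM v1
    refine ⟨v2, ⟨?_⟩⟩
    rw [Nat.add_comm m n, Nat.add_assoc]
    exact EvalsToInTime.trans _ _ _ _ _ _ (EvalsToInTime.trans _ _ _ _ _ _
      (evalsTo_loop_pop M (hM (Sum.inl ())) v s) h1) h2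
  | mono _ hle ih =>
    intro emb exit hM v
    obtain ⟨v1, ⟨h1⟩⟩ := ih emb exit hM v
    exact ⟨v1, ⟨⟨h1.toEvalsTo, h1.steps_le_m.trans hle⟩⟩⟩

/-- The stack machine that runs a program and halts. -/
def machine [DecidableEq K] [Fintype K] [Fintype Γ] (p : Prog K Γ) (k₀ k₁ : K) : FinTM2 where
  K := K
  k₀ := k₀
  k₁ := k₁
  Γ _ := Γ
  Λ := Option p.Lab
  main := some p.entry
  σ := Option Γ
  initialState := none
  m
    -- The final configuration `haltList` demands the initial value of the local variable; restoring
    -- it costs the extra step in `time + 1` below.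
    | none => .load (fun _ => none) .halt
    | some l => p.code some none l

theorem initList_machine [DecidableEq K] [Fintype K] [Fintype Γ] (p : Prog K Γ) (k₀ k₁ : K)
    (w : List Γ) : initList (p.machine k₀ k₁) w =
      (⟨some (some p.entry), none, update (fun _ => []) k₀ w⟩ :
        TM2.Cfg (fun _ : K => Γ) (Option p.Lab) (Option Γ)) := by
  unfold initList
  congr 1
  funext k
  by_cases h : k = k₀
  · cases h
    exact (dif_pos rfl).trans (update_self (β := fun _ : K => List Γ) k₀ w fun _ => []).symm
  · exact (dif_neg h).trans (update_of_ne (β := fun _ : K => List Γ) h w fun _ => []).symm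

theorem haltList_machine [DecidableEq K] [Fintype K] [Fintype Γ] (p : Prog K Γ) (k₀ k₁ : K)
    (w : List Γ) : haltList (p.machine k₀ k₁) w =
      (⟨none, none, update (fun _ => []) k₁ w⟩ :
        TM2.Cfg (fun _ : K => Γ) (Option p.Lab) (Option Γ)) := by
  unfold haltList
  congr 1
  funext k
  by_cases h : k = k₁
  · cases h
    exact (dif_pos rfl).trans (update_self (β := fun _ : K => List Γ) k₁ w fun _ => []).symm
  · exact (dif_neg h).trans (update_of_ne (β := fun _ : K => List Γ) h w fun _ => []).symm

/-- A program that takes the code of `a` on the stack `k₀` to the code of `f a` on the stack `k₁`,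
within a number of steps that is polynomial in the length of the input, makes `f` computable in
polynomial time. -/
theorem computableInPolyTime [DecidableEq K] [Fintype K] [Fintype Γ] (p : Prog K Γ) (k₀ k₁ : K)
    {α β : Type} (ea : α → List Γ) (eb : β → List Γ) (f : α → β) (time : Polynomial ℕ)
    (h : ∀ a, Exec p (update (fun _ => []) k₀ (ea a)) (update (fun _ => []) k₁ (eb (f a)))
      (time.eval (ea a).length)) :
    Nonempty (TM2ComputableInPolyTime ea eb f) := by
  refine ⟨⟨⟨p.machine k₀ k₁, Equiv.refl _, Equiv.refl _⟩, time + 1, fun a => ?_⟩⟩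
  refine Classical.choice ?_
  obtain ⟨v, ⟨h1⟩⟩ := evalsTo_of_exec (p.machine k₀ k₁).m (h a) some none (fun _ => rfl) none
  have e0 : initList (p.machine k₀ k₁) ((ea a).map (Equiv.refl Γ).invFun) =
      ⟨some (some p.entry), none, update (fun _ => []) k₀ (ea a)⟩ :=
    (congrArg (initList (p.machine k₀ k₁)) (List.map_id (ea a))).trans
      (initList_machine p k₀ k₁ (ea a))
  have e1 : haltList (p.machine k₀ k₁) ((eb (f a)).map (Equiv.refl Γ).invFun) =
      ⟨none, none, update (fun _ => []) k₁ (eb (f a))⟩ :=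
    (congrArg (haltList (p.machine k₀ k₁)) (List.map_id (eb (f a)))).trans
      (haltList_machine p k₀ k₁ (eb (f a)))
  refine ⟨?_⟩
  unfold TM2OutputsInTime
  rw [Polynomial.eval_add, Polynomial.eval_one, Nat.add_comm]
  refine EvalsToInTime.trans _ _ _ _ (⟨some none, v, update (fun _ => []) k₁ (eb (f a))⟩ :
    TM2.Cfg (fun _ : K => Γ) (Option p.Lab) (Option Γ)) _ ?_ ⟨⟨1, ?_⟩, le_rfl⟩
  · erw [e0]
    exact h1
  · erw [Option.map_some, e1]
    rfl

end Prog

end KSSim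

namespace KSSim

theorem Lit.dual_dual (a : Lit) : a.dual.dual = a := by
  cases a; simp [Lit.dual]

theorem Lit.dual_ne (a : Lit) : a.dual ≠ a := by
  cases a; simp [Lit.dual]

theorem Lit.dual_eq_iff {a b : Lit} : a.dual = b ↔ a = b.dual :=
  ⟨fun h => by rw [← h, dual_dual], fun h => by rw [h, dual_dual]⟩

/-! ### Formulae modulo the congruence -/

namespace Formula

instance eqvSetoid : Setoid Formula := ⟨Eqv, ⟨.refl, .symm, .trans⟩⟩

theorem Eqv.or {A A' B B' : Formula} (h : Eqv A A') (h' : Eqv B B') :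
    Eqv (A.or B) (A'.or B') :=
  .trans (.or_ctx A h') (.trans (.or_comm _ _) (.trans (.or_ctx B' h) (.or_comm _ _)))

theorem Eqv.and {A A' B B' : Formula} (h : Eqv A A') (h' : Eqv B B') :
    Eqv (A.and B) (A'.and B') :=
  .trans (.and_ctx A h') (.trans (.and_comm _ _) (.trans (.and_ctx B' h) (.and_comm _ _)))

/-- Formulae modulo the congruence, as an additive monoid under disjunction. -/
abbrev Cls : Type := Quotient eqvSetoid

instance : Add Cls := ⟨Quotient.map₂ Formula.or fun _ _ h _ _ h' => h.or h'⟩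

instance : Zero Cls := ⟨⟦bot⟧⟩

/-- With disjunction as addition, rearranging disjuncts and inserting $\bot$ becomes a computation
for `abel`. -/
instance : AddCommMonoid Cls where
  nsmul := nsmulRec
  add_assoc := by
    rintro ⟨A⟩ ⟨B⟩ ⟨C⟩
    exact Quotient.sound (.or_assoc A B C)
  zero_add := by
    rintro ⟨A⟩
    exact Quotient.sound (.trans (.or_comm _ _) (.or_bot A))
  add_zero := by
    rintro ⟨A⟩
    exact Quotient.sound (.or_bot A)
  add_comm := by
    rintro ⟨A⟩ ⟨B⟩
    exact Quotient.sound (.or_comm A B)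

theorem cls_or (A B : Formula) : (⟦A.or B⟧ : Cls) = ⟦A⟧ + ⟦B⟧ := rfl

theorem cls_bot : (⟦bot⟧ : Cls) = 0 := rfl

theorem cls_and_top (A : Formula) : (⟦A.and top⟧ : Cls) = ⟦A⟧ := Quotient.sound (.and_top A)

theorem eqv_iff {A B : Formula} : Eqv A B ↔ (⟦A⟧ : Cls) = ⟦B⟧ :=
  ⟨fun h => Quotient.sound h, fun h => Quotient.exact h⟩

end Formula

open Formula

/-! ### Normal forms for the duals of clauses. -/

/-- The conjunction of the duals of the literals of a clause. -/
def conj (c : Clause) : Formula := c.foldr (fun x A => .and (.lit x.dual) A) .top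

/-- The disjunction of the formulae `conj c` over the clauses `c` of a list. -/
def disj (L : List Clause) : Formula := L.foldr (fun c A => .or (conj c) A) (.or .bot .bot)

theorem conj_append (c d : Clause) : Eqv (conj (c ++ d)) (.and (conj c) (conj d)) := by
  induction c with
  | nil => exact .trans (.symm (.and_top _)) (.and_comm _ _)
  | cons x c ih => exact .trans (.and_ctx _ ih) (.symm (.and_assoc _ _ _))

/-- Brings the resolved occurrence to the right end, the shape $\bar c\wedge\bar u$ that switch
produces. -/
theorem conj_insert (x : Lit) (c d : Clause) :
    Eqv (conj (c ++ x :: d)) (.and (conj (c ++ d)) (.lit x.dual)) := by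
  refine .trans (conj_append c (x :: d)) ?_
  refine .trans (.and_ctx _ (.and_comm _ _)) (.trans (.symm (.and_assoc _ _ _)) ?_)
  exact .and (.symm (conj_append c d)) (.refl _)

theorem cls_disj_cons (c : Clause) (L : List Clause) :
    (⟦disj (c :: L)⟧ : Cls) = ⟦conj c⟧ + ⟦disj L⟧ := rfl

theorem cls_disj_append (L M : List Clause) :
    (⟦disj (L ++ M)⟧ : Cls) = ⟦disj L⟧ + ⟦disj M⟧ := by
  induction L with
  | nil =>
    change _ = ⟦Formula.or bot bot⟧ + _
    rw [cls_or, cls_bot, zero_add, zero_add]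
    rfl
  | cons c L ih => rw [List.cons_append, cls_disj_cons, ih, cls_disj_cons, add_assoc]

theorem cls_disj_insert (c : Clause) (L M : List Clause) :
    (⟦disj (L ++ c :: M)⟧ : Cls) = ⟦conj c⟧ + ⟦disj (L ++ M)⟧ := by
  rw [cls_disj_append, cls_disj_cons, cls_disj_append, add_left_comm]

theorem eqv_dual_bigOr (c : Clause) : Eqv (bigOr (c.map Formula.lit)).dual (conj c) := by
  induction c with
  | nil => exact .refl _
  | cons x c ih =>
    cases c with
    | nil => exact .symm (.and_top _)
    | cons y c => exact .and_ctx _ ih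

theorem eqv_dual_cnf (Γ : List Clause) : Eqv (cnf Γ).dual (disj Γ) := by
  induction Γ with
  | nil => exact .symm (.or_bot _)
  | cons c Γ ih =>
    cases Γ with
    | nil =>
      refine .trans (eqv_dual_bigOr c) (eqv_iff.2 ?_)
      rw [cls_disj_cons]
      change _ = _ + ⟦Formula.or bot bot⟧
      rw [cls_or, cls_bot, add_zero, add_zero]
    | cons d Γ => exact .or (eqv_dual_bigOr c) ih

/-! ### Unit propagation -/

/-- The first unit clause of a list, and the list without it. -/
def extractUnit : List Clause → Option (Lit × List Clause)
  | [] => none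
  | [a] :: L => some (a, L)
  | c :: L => (extractUnit L).map fun r => (r.1, c :: r.2)

/-- The first clause that contains the literal `u`, without one occurrence of `u`, and the list of
the other clauses. -/
def extractLit (u : Lit) : List Clause → Option (Clause × List Clause)
  | [] => none
  | c :: L => if u ∈ c then some (c.erase u, L) else
      (extractLit u L).map fun r => (r.1, c :: r.2)

theorem extractUnit_cons_of_ne {c : Clause} {L : List Clause} (h : c.length ≠ 1) :
    extractUnit (c :: L) = (extractUnit L).map fun r => (r.1, c :: r.2) := by
  match c, h with
  | [], _ => rfl
  | _ :: _ :: _, _ => rfl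

theorem extractUnit_none {L : List Clause} (h : extractUnit L = none) :
    ∀ c ∈ L, c.length ≠ 1 := by
  induction L with
  | nil => simp
  | cons c L ih =>
    by_cases hc : c.length = 1
    · obtain ⟨a, rfl⟩ := List.length_eq_one_iff.1 hc
      simp [extractUnit] at h
    · rw [extractUnit_cons_of_ne hc, Option.map_eq_none_iff] at h
      simpa [hc] using ih h

/-- The logical part needs only the splitting. That no unit precedes the chosen one is what the
scanning program relies on (`exec_scan_body`); the last two clauses of `extractLit_some` serve the
search for a literal in the same way. -/
theorem extractUnit_some {L X : List Clause} {a : Lit} (h : extractUnit L = some (a, X)) :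
    ∃ L₁ L₂, L = L₁ ++ [a] :: L₂ ∧ X = L₁ ++ L₂ ∧ ∀ c ∈ L₁, c.length ≠ 1 := by
  induction L generalizing X with
  | nil => simp [extractUnit] at h
  | cons c L ih =>
    by_cases hc : c.length = 1
    · obtain ⟨b, rfl⟩ := List.length_eq_one_iff.1 hc
      simp only [extractUnit, Option.some.injEq, Prod.mk.injEq] at h
      exact ⟨[], L, by simp [h.1], by simp [h.2], by simp⟩
    · rw [extractUnit_cons_of_ne hc, Option.map_eq_some_iff] at h
      obtain ⟨⟨b, Y⟩, h1, h2⟩ := h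
      simp only [Prod.mk.injEq] at h2
      obtain ⟨rfl, rfl⟩ := h2
      obtain ⟨L₁, L₂, rfl, rfl, h3⟩ := ih h1
      exact ⟨c :: L₁, L₂, rfl, rfl, by simpa [hc] using h3⟩

theorem extractLit_none {u : Lit} {L : List Clause} (h : extractLit u L = none) :
    ∀ c ∈ L, u ∉ c := by
  induction L with
  | nil => simp
  | cons c L ih =>
    by_cases hc : u ∈ c
    · simp [extractLit, hc] at h
    · rw [extractLit, if_neg hc, Option.map_eq_none_iff] at h
      simpa [hc] using ih h

theorem extractLit_some {u : Lit} {L X : List Clause} {c : Clause}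
    (h : extractLit u L = some (c, X)) :
    ∃ L₁ p q L₂, L = L₁ ++ (p ++ u :: q) :: L₂ ∧ c = p ++ q ∧ X = L₁ ++ L₂ ∧ u ∉ p ∧
      ∀ d ∈ L₁, u ∉ d := by
  induction L generalizing X with
  | nil => simp [extractLit] at h
  | cons d L ih =>
    by_cases hd : u ∈ d
    · simp only [extractLit, if_pos hd, Option.some.injEq, Prod.mk.injEq] at h
      obtain ⟨p, q, h1, rfl, h2⟩ := List.exists_erase_eq hd
      exact ⟨[], p, q, L, by simp, by rw [← h.1, h2], by simp [h.2], h1, by simp⟩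
    · rw [extractLit, if_neg hd, Option.map_eq_some_iff] at h
      obtain ⟨⟨b, Y⟩, h1, h2⟩ := h
      simp only [Prod.mk.injEq] at h2
      obtain ⟨rfl, rfl⟩ := h2
      obtain ⟨L₁, p, q, L₂, rfl, rfl, rfl, h3, h4⟩ := ih h1
      exact ⟨d :: L₁, p, q, L₂, rfl, rfl, rfl, h3, by simpa [hd] using h4⟩

/-- The derivation that adds the unit clause `u.dual` to the clauses `L` by weakening. -/
def dropDeriv (u : Lit) (L : List Clause) (D : Deriv) : Deriv :=
  .step .eq (.or (.fm (disj L)) (.step .awd (.fm .bot) (.fm (.lit u)))) D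

/-- The derivation that simulates the resolution of the unit clause `u.dual` with a clause that
consists of `c` and `u`, in the presence of the clauses `X`. -/
def resDeriv (u : Lit) (c : Clause) (X : List Clause) (D : Deriv) : Deriv :=
  .step .eq
    (.or (.or (.fm (.lit u)) (.fm (disj X)))
      (.step .swi
        (.and (.fm (conj c)) (.step .aid (.fm .top) (.fm (.or (.lit u.dual) (.lit u)))))
        (.fm (.or (.and (conj c) (.lit u.dual)) (.lit u)))))
    (.step .eq
      (.or (.or (.fm (.and (conj c) (.lit u.dual))) (.fm (disj X)))
        (.step .acd (.fm (.or (.lit u) (.lit u))) (.fm (.lit u))))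
      D)

/-- Unit propagation. A resolution of a unit clause with another clause replaces the latter by the
resolvent, and a unit clause is dropped when no such resolution is left. The derivation `D`, whose
premiss is the formula of the given clauses, is extended upwards such that its premiss is the
formula of the clauses that are left. -/
def unitProp (L : List Clause) (D : Deriv) : List Clause × Deriv :=
  match _h : extractUnit L with
  | none => (L, D)
  | some (a, L₁) =>
    match _h' : extractLit a.dual L₁ with
    | none => unitProp L₁ (dropDeriv a.dual L₁ D)
    | some (c, X) => unitProp (c :: [a] :: X) (resDeriv a.dual c X D)
-- The measure counts literal occurrences. Dropping removes the unit; resolving keeps the unit and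
-- removes one occurrence of its dual.
termination_by L.flatten.length
decreasing_by
  · obtain ⟨L₁, L₂, rfl, rfl, -⟩ := extractUnit_some _h
    simp
  · obtain ⟨L₁, L₂, rfl, h2, -⟩ := extractUnit_some _h
    obtain ⟨M₁, p, q, M₂, h3, rfl, rfl, -, -⟩ := extractLit_some _h'
    have h4 := congrArg (fun l => l.flatten.length) (h2.symm.trans h3)
    simp only [List.flatten_append, List.flatten_cons, List.length_append, List.length_cons,
      List.length_nil] at h4 ⊢
    omega

/-- The derivation from units that introduces all literals of the duals of the clauses by
weakening. -/
def weakDeriv (L : List Clause) : Deriv :=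
  L.foldr (fun c Φ => .or
    (c.foldr (fun x Ψ => .and (.step .awd (.fm .bot) (.fm (.lit x.dual))) Ψ) (.fm .top)) Φ)
    (.or (.fm .bot) (.fm .bot))

/-- The derivation found by unit propagation. It is a proof if the empty clause is reached. -/
def unitDeriv (Γ : List Clause) : Deriv :=
  .step .eq (.fm .top) (.step .eq (weakDeriv (unitProp Γ (.fm (cnf Γ).dual)).1)
    (unitProp Γ (.fm (cnf Γ).dual)).2)

/-! ### Soundness -/

theorem dropDeriv_valid {a : Lit} {L L₁ : List Clause} {D : Deriv}
    (h : extractUnit L = some (a, L₁)) (hD : D.Valid) (hp : Eqv (disj L) D.pr) :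
    (dropDeriv a.dual L₁ D).Valid ∧ Eqv (disj L₁) (dropDeriv a.dual L₁ D).pr := by
  obtain ⟨M₁, M₂, rfl, rfl, -⟩ := extractUnit_some h
  refine ⟨⟨⟨trivial, trivial, trivial, .awd _⟩, hD, .eq (.trans ?_ hp)⟩, .symm (.or_bot _)⟩
  rw [eqv_iff, cls_disj_insert]
  change ⟦Formula.or _ _⟧ = ⟦Formula.and (Formula.lit _) top⟧ + _
  rw [cls_or, cls_and_top, add_comm]
  rfl

/-- Identity and switch create a second copy of `a.dual` next to the one contributed by the unit;
contraction merges them. The copy above belongs to the unit that is kept in the new list. -/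
theorem resDeriv_valid {a : Lit} {L L₁ X : List Clause} {c : Clause} {D : Deriv}
    (h : extractUnit L = some (a, L₁)) (h' : extractLit a.dual L₁ = some (c, X))
    (hD : D.Valid) (hp : Eqv (disj L) D.pr) :
    (resDeriv a.dual c X D).Valid ∧
      Eqv (disj (c :: [a] :: X)) (resDeriv a.dual c X D).pr := by
  obtain ⟨M₁, M₂, rfl, h2, -⟩ := extractUnit_some h
  obtain ⟨N₁, p, q, N₂, h3, rfl, rfl, -, -⟩ := extractLit_some h'
  have e : (⟦conj [a]⟧ : Cls) = ⟦lit a.dual⟧ := cls_and_top _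
  refine ⟨⟨⟨⟨trivial, trivial⟩, ⟨trivial, trivial, trivial, ?_⟩, trivial, .swi _ _ _⟩,
    ⟨⟨⟨trivial, trivial⟩, trivial, trivial, .acd _⟩, hD, .eq (.trans ?_ hp)⟩, .eq ?_⟩, ?_⟩
  -- With $u$ = `a.dual`, the identity has to yield $\bar u\vee u$ in this order, so it is taken at
  -- $\bar u$.
  · have := RuleInst.aid a.dual.dual
    rwa [Lit.dual_dual] at this ⊢
  · rw [eqv_iff, cls_disj_insert, ← h2, h3, cls_disj_insert, eqv_iff.1 (conj_insert _ _ _), e]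
    simp only [Deriv.cn, cls_or]
    abel
  · simp only [eqv_iff, Deriv.cn, Deriv.pr, cls_or]
    abel
  · rw [eqv_iff, cls_disj_cons, cls_disj_cons, e]
    change _ = ((⟦lit a.dual⟧ : Cls) + ⟦disj (N₁ ++ N₂)⟧) + ⟦Formula.and (conj (p ++ q)) top⟧
    rw [cls_and_top]
    abel

theorem unitProp_valid (L : List Clause) (D : Deriv) (hD : D.Valid) (hp : Eqv (disj L) D.pr) :
    (unitProp L D).2.Valid ∧ Eqv (disj (unitProp L D).1) (unitProp L D).2.pr ∧
      (unitProp L D).2.cn = D.cn := by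
  fun_induction unitProp L D with
  | case1 L D h => exact ⟨hD, hp, rfl⟩
  | case2 L D a L₁ h h' ih =>
    obtain ⟨h1, h2⟩ := dropDeriv_valid h hD hp
    exact ih h1 h2
  | case3 L D a L₁ h c X h' ih =>
    obtain ⟨h1, h2⟩ := resDeriv_valid h h' hD hp
    exact ih h1 h2

theorem weakDeriv_valid (L : List Clause) : (weakDeriv L).Valid := by
  induction L with
  | nil => exact ⟨trivial, trivial⟩
  | cons c L ih =>
    refine ⟨?_, ih⟩
    induction c with
    | nil => trivial
    | cons x c ih' => exact ⟨⟨trivial, trivial, .awd _⟩, ih'⟩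

theorem weakDeriv_cn (L : List Clause) : (weakDeriv L).cn = disj L := by
  induction L with
  | nil => rfl
  | cons c L ih =>
    refine congrArg₂ Formula.or ?_ ih
    induction c with
    | nil => rfl
    | cons x c ih' => exact congrArg _ ih'

/-- Every literal starts from $\bot$, so a nonempty clause collapses to $\bot$ by
$\bot\wedge\bot=\bot$ and $\bot\wedge\top=\bot$. An empty clause leaves its $\top$, and several of
them merge by $\top\vee\top=\top$. -/
theorem weakDeriv_pr (L : List Clause) :
    (⟦(weakDeriv L).pr⟧ : Cls) = if [] ∈ L then ⟦top⟧ else 0 := by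
  induction L with
  | nil => exact add_zero (0 : Cls)
  | cons c L ih =>
    have h : (⟦(weakDeriv (c :: L)).pr⟧ : Cls) =
        ⟦(c.foldr (fun x Ψ => Deriv.and (.step .awd (.fm .bot) (.fm (.lit x.dual))) Ψ)
          (.fm .top)).pr⟧ + ⟦(weakDeriv L).pr⟧ := rfl
    rw [h, ih]
    cases c with
    | nil =>
      have ht : (⟦top⟧ : Cls) + ⟦top⟧ = ⟦top⟧ := Quotient.sound .top_or_top
      simp only [List.mem_cons, true_or, if_true]
      split_ifs
      · exact ht
      · exact add_zero _
    | cons x c =>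
      have hb : ∀ d : Clause, (⟦bot.and (d.foldr (fun x Ψ =>
          Deriv.and (.step .awd (.fm .bot) (.fm (.lit x.dual))) Ψ) (.fm .top)).pr⟧ : Cls) = 0 := by
        intro d
        refine Quotient.sound ?_
        induction d with
        | nil => exact .and_top _
        | cons y d ih => exact .trans (.and_ctx _ ih) .bot_and_bot
      have := hb c
      simp only [List.mem_cons, reduceCtorEq, false_or]
      exact (congrArg (· + if [] ∈ L then (⟦top⟧ : Cls) else 0) this).trans (zero_add _)

theorem unitDeriv_isKSProof {Γ : List Clause}
    (h : [] ∈ (unitProp Γ (.fm (cnf Γ).dual)).1) : (unitDeriv Γ).IsKSProof (cnf Γ).dual := by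
  obtain ⟨h1, h2, h3⟩ := unitProp_valid Γ (.fm (cnf Γ).dual) trivial (.symm (eqv_dual_cnf Γ))
  refine ⟨⟨trivial, ⟨weakDeriv_valid _, h1, .eq ?_⟩, .eq ?_⟩, rfl, h3⟩
  · rw [weakDeriv_cn]
    exact h2
  · refine eqv_iff.2 (Eq.trans ?_ (weakDeriv_pr _).symm)
    rw [if_pos h]
    rfl

/-! ### Completeness -/

open Classical in
/-- The literals of a multiset whose duals are not in `U`. -/
noncomputable def resid (U : Set Lit) (C : Multiset Lit) : Multiset Lit :=
  C.filter fun x => x.dual ∉ U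

/-- A clause that is not falsified by `U`, and whose only literal that is not falsified, if there
is just one, is in `U`. -/
def Stable (U : Set Lit) (C : Multiset Lit) : Prop :=
  resid U C ≠ 0 ∧ ∀ x, resid U C = {x} → x ∈ U

theorem mem_resid {U : Set Lit} {C : Multiset Lit} {x : Lit} :
    x ∈ resid U C ↔ x ∈ C ∧ x.dual ∉ U := by
  simp [resid]

open Classical in
-- Used when a unit is dropped and the set of literals has to be changed.
theorem resid_le {U V : Set Lit} {C : Multiset Lit}
    (h : ∀ x ∈ C, x.dual ∉ U → x.dual ∉ V) : resid U C ≤ resid V C :=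
  Multiset.le_filter.2 ⟨Multiset.filter_le _ _, fun x hx =>
    h x (mem_resid.1 hx).1 (mem_resid.1 hx).2⟩

theorem resid_add (U : Set Lit) (C D : Multiset Lit) :
    resid U (C + D) = resid U C + resid U D := by
  simp [resid, Multiset.filter_add]

theorem resid_singleton_of_mem {U : Set Lit} {a : Lit} (h : a.dual ∈ U) : resid U {a} = 0 := by
  simp [resid, Multiset.filter_singleton, h]

theorem resid_singleton_of_notMem {U : Set Lit} {a : Lit} (h : a.dual ∉ U) :
    resid U {a} = {a} := by
  simp [resid, Multiset.filter_singleton, h]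

/-- Residues add up. If the sum has one element, the nonempty residue of `C` already accounts for
it. -/
theorem Stable.add {U : Set Lit} {C D : Multiset Lit} (h : Stable U C) : Stable U (C + D) := by
  refine ⟨fun h0 => h.1 ?_, fun x hx => ?_⟩
  · rw [resid_add] at h0
    exact (add_eq_zero.1 h0).1
  · rw [resid_add] at hx
    have h1 := congrArg Multiset.card hx
    have h2 := Multiset.card_pos.2 h.1
    simp only [Multiset.card_add, Multiset.card_singleton] at h1
    have h3 : resid U D = 0 := Multiset.card_eq_zero.1 (by omega)
    exact h.2 x (by rw [← hx, h3, add_zero])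

/-- If `a` or its dual lies in `U`, one premiss loses its resolved literal to `U`, and its other
part is stable by itself. Otherwise neither resolved literal can be all that is left of its premiss,
so `C` and `D` both have nonempty residues and the resolvent keeps at least two occurrences.
Counting with multiplicity, the absence of contraction, enters here: with $U=\emptyset$ the
unsatisfiable clauses $\{x,x\}$ and $\{\bar x,\bar x\}$ are stable. -/
theorem Stable.resolvent {U : Set Lit} {C D : Multiset Lit} {a : Lit}
    (hC : Stable U (C + {a})) (hD : Stable U (D + {a.dual})) : Stable U (C + D) := by
  by_cases h : a ∈ U
  · have : resid U (D + {a.dual}) = resid U D := by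
      rw [resid_add, resid_singleton_of_mem (by rwa [Lit.dual_dual]), add_zero]
    rw [add_comm]
    unfold Stable at hD
    rw [this] at hD
    exact Stable.add hD
  by_cases h' : a.dual ∈ U
  · have : resid U (C + {a}) = resid U C := by
      rw [resid_add, resid_singleton_of_mem h', add_zero]
    unfold Stable at hC
    rw [this] at hC
    exact Stable.add hC
  have key : ∀ {E : Multiset Lit} {b : Lit}, b ∉ U → b.dual ∉ U → Stable U (E + {b}) →
      0 < Multiset.card (resid U E) := by
    intro E b hb hb' hE
    rw [Multiset.card_pos]
    intro h0
    exact hb (hE.2 b (by rw [resid_add, h0, resid_singleton_of_notMem hb', zero_add]))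
  have h1 := key h h' hC
  have h2 := key h' (by rwa [Lit.dual_dual]) hD
  refine ⟨fun h0 => ?_, fun x hx => ?_⟩
  · rw [resid_add, add_eq_zero] at h0
    rw [h0.1] at h1
    simp at h1
  · rw [resid_add] at hx
    have h3 := congrArg Multiset.card hx
    simp only [Multiset.card_add, Multiset.card_singleton] at h3
    omega

theorem Stable.of_derivation {U : Set Lit} {Γ π : List (Multiset Lit)}
    (hΓ : ∀ C ∈ Γ, Stable U C) (hπ : ResDerivation Γ π) : ∀ C ∈ π, Stable U C := by
  induction hπ with
  | nil => simp
  | init _ hC ih =>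
    intro E hE
    rcases List.mem_append.1 hE with h | h
    · exact ih E h
    · rw [List.mem_singleton.1 h]
      exact hΓ _ hC
  | wk D _ hC ih =>
    intro E hE
    rcases List.mem_append.1 hE with h | h
    · exact ih E h
    · rw [List.mem_singleton.1 h]
      exact (ih _ hC).add
  | res a _ hC hD ih =>
    intro E hE
    rcases List.mem_append.1 hE with h | h
    · exact ih E h
    · rw [List.mem_singleton.1 h]
      exact Stable.resolvent (ih _ hC) (ih _ hD)

/-- If unit propagation does not reach the empty clause, then the clauses are stable with respect
to some set of literals. -/
theorem exists_stable (L : List Clause) (D : Deriv) (h0 : [] ∉ (unitProp L D).1) :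
    ∃ U : Set Lit, ∀ c ∈ L, Stable U (c : Multiset Lit) := by
  fun_induction unitProp L D with
  | case1 L D h =>
    -- With no literals struck out, stability means that no clause is empty or unit, which is where
    -- propagation stops.
    refine ⟨∅, fun c hc => ?_⟩
    have e : resid ∅ (c : Multiset Lit) = c := by simp [resid]
    refine ⟨?_, fun x hx => ?_⟩
    · rw [e]
      rintro h1
      rw [Multiset.coe_eq_zero] at h1
      exact h0 (h1 ▸ hc)
    · rw [e] at hx
      exact absurd (congrArg Multiset.card hx) (extractUnit_none h c hc)
  | case2 L D a L₁ h h' ih =>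
    obtain ⟨U, hs⟩ := ih h0
    have hn := extractLit_none h'
    obtain ⟨M₁, M₂, rfl, rfl, -⟩ := extractUnit_some h
    -- The dropped unit needs `a` in the set and `a.dual` outside it. No other clause contains
    -- `a.dual`, so inserting `a` strikes nothing from them, and removing `a.dual` only enlarges
    -- their residues.
    refine ⟨insert a (U \ {a.dual}), ?_⟩
    have hnd : a.dual ∉ insert a (U \ {a.dual}) := by
      rintro (h1 | ⟨-, h1⟩)
      · exact Lit.dual_ne _ h1
      · exact h1 rfl
    have hr : ∀ c ∈ M₁ ++ M₂, Stable (insert a (U \ {a.dual})) (c : Multiset Lit) := by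
      intro c hc
      have hle : resid U (c : Multiset Lit) ≤ resid (insert a (U \ {a.dual})) c := by
        refine resid_le fun x hx h2 => ?_
        rintro (h3 | ⟨h3, -⟩)
        · rw [Lit.dual_eq_iff] at h3
          exact hn c hc (h3 ▸ hx)
        · exact h2 h3
      obtain ⟨h1, h2⟩ := hs c hc
      refine ⟨fun h3 => h1 (Multiset.le_zero.1 (h3 ▸ hle)), fun x hx => ?_⟩
      rw [hx, Multiset.le_singleton] at hle
      have h3 := hle.resolve_left h1
      refine Or.inr ⟨h2 x h3, fun h4 => hn c hc ?_⟩
      have h5 : x ∈ resid U (c : Multiset Lit) := by simp [h3]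
      exact (show x = a.dual from h4) ▸ (mem_resid.1 h5).1
    intro c hc
    rw [List.mem_append, List.mem_cons, or_left_comm, ← List.mem_append] at hc
    rcases hc with rfl | hc
    · have e := resid_singleton_of_notMem hnd
      refine ⟨?_, fun x hx => ?_⟩
      · erw [e]
        simp
      · erw [e, Multiset.singleton_inj] at hx
        exact Or.inl hx.symm
    · exact hr c hc
  | case3 L D a L₁ h c X h' ih =>
    obtain ⟨U, hs⟩ := ih h0
    obtain ⟨M₁, M₂, rfl, h2, -⟩ := extractUnit_some h
    obtain ⟨N₁, p, q, N₂, h3, rfl, rfl, -, -⟩ := extractLit_some h'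
    -- The same set works: the resolvent is stable by the induction hypothesis, and the clause it
    -- came from has just one more literal.
    refine ⟨U, fun d hd => ?_⟩
    rw [List.mem_append, List.mem_cons, or_left_comm, ← List.mem_append, ← h2, h3,
      List.mem_append, List.mem_cons, or_left_comm (b := d = _), ← List.mem_append] at hd
    rcases hd with rfl | rfl | hd
    · exact hs _ (by simp)
    · have ha : a.dual ∉ U := fun h4 =>
        (hs [a] (by simp)).1 (resid_singleton_of_mem h4)
      have ha' : a ∈ U := (hs [a] (by simp)).2 a (resid_singleton_of_notMem ha)
      have e : ((p ++ a.dual :: q : List Lit) : Multiset Lit) =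
          ((p ++ q : List Lit) : Multiset Lit) + {a.dual} := by
        rw [← Multiset.coe_add, ← Multiset.coe_add, ← Multiset.cons_coe,
          ← Multiset.singleton_add]
        abel
      rw [e]
      exact (hs (p ++ q) (by simp)).add
    · exact hs d (by simp [hd])

theorem nil_mem_unitProp {Γ π : List Clause} (D : Deriv)
    (h : IsRefutation (toMultisets Γ) (toMultisets π)) : [] ∈ (unitProp Γ D).1 := by
  by_contra h0
  obtain ⟨U, hs⟩ := exists_stable Γ D h0
  have h1 : ∀ C ∈ toMultisets Γ, Stable U C := by
    intro C hC
    simp only [toMultisets, List.map_id_fun', id_eq, List.pure_def, List.bind_eq_flatMap,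
      List.mem_flatMap, List.mem_singleton] at hC
    obtain ⟨c, hc, rfl⟩ := hC
    exact hs _ hc
  have h2 := Stable.of_derivation h1 h.1 0 (List.mem_of_getLast? h.2)
  exact h2.1 (by simp [resid])

end KSSim

namespace KSSim

open Function

/-! ### Programs over stacks -/

section Programs

variable {K Γ : Type} [DecidableEq K]

theorem Exec.congr {p : Prog K Γ} {s s' s'' : K → List Γ} {m n : ℕ} (h : Exec p s s' m)
    (hs : s' = s'') (hn : m ≤ n) : Exec p s s'' n :=
  hs ▸ h.mono hn

theorem Exec.loop_cons {k : K} {p : Option Γ → Prog K Γ} {c : Option Γ → Bool}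
    {s s' s'' : K → List Γ} {x : Γ} {w : List Γ} {m n : ℕ} (hs : s k = x :: w)
    (hc : c (some x) = true) (h : Exec (p (some x)) (update s k w) s' m)
    (h' : Exec (.loop k p c) s' s'' n) : Exec (.loop k p c) s s'' (m + n + 1) := by
  refine .loop_next ?_ ?_ h'
  · rw [hs]
    exact hc
  · rw [hs]
    exact h

theorem Exec.loop_cons_exit {k : K} {p : Option Γ → Prog K Γ} {c : Option Γ → Bool}
    {s s' : K → List Γ} {x : Γ} {w : List Γ} {m : ℕ} (hs : s k = x :: w)
    (hc : c (some x) = false) (h : Exec (p (some x)) (update s k w) s' m) :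
    Exec (.loop k p c) s s' (m + 1) := by
  refine .loop_exit ?_ ?_
  · rw [hs]
    exact hc
  · rw [hs]
    exact h

theorem Exec.loop_nil_exit {k : K} {p : Option Γ → Prog K Γ} {c : Option Γ → Bool}
    {s s' : K → List Γ} {m : ℕ} (hs : s k = []) (hc : c none = false)
    (h : Exec (p none) s s' m) : Exec (.loop k p c) s s' (m + 1) := by
  refine .loop_exit ?_ ?_
  · rw [hs]
    exact hc
  · rw [hs, List.head?_nil, List.tail_nil, ← hs, update_eq_self]
    exact h

namespace Prog

/-- Pop the stack `k` and run the program selected by the result. -/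
def pop (k : K) (p : Option Γ → Prog K Γ) : Prog K Γ := .loop k p fun _ => false

/-- Push a list, its last element first. -/
def pushList (k : K) : List Γ → Prog K Γ
  | [] => .skip
  | x :: l => .seq (pushList k l) (.push k x)

/-- Move symbols from `k` to `j`, up to and including the first one that satisfies `halt`. -/
def move (k j : K) (halt : Γ → Bool) : Prog K Γ :=
  .loop k (fun x => x.elim .skip (.push j)) fun x => x.elim false fun y => !halt y

/-- Remove all symbols of the stack `k`. -/
def clear (k : K) : Prog K Γ := .loop k (fun _ => .skip) Option.isSome

end Prog

theorem Exec.pop {k : K} {p : Option Γ → Prog K Γ} {s s' : K → List Γ} {o : Option Γ}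
    {t : List Γ} {m : ℕ} (ho : (s k).head? = o) (ht : (s k).tail = t)
    (h : Exec (p o) (update s k t) s' m) : Exec (.pop k p) s s' (m + 1) := by
  subst ho ht
  exact .loop_exit rfl h

theorem exec_pushList (k : K) (l : List Γ) (s : K → List Γ) :
    Exec (.pushList k l) s (update s k (l ++ s k)) (l.length + 1) := by
  induction l with
  | nil =>
    rw [List.nil_append, update_eq_self]
    exact .skip s
  | cons x l ih =>
    have h := Exec.seq ih (.push k x _)
    rw [update_self, update_idem] at h
    exact h

theorem exec_clear (k : K) (s : K → List Γ) :
    Exec (.clear k) s (update s k []) (2 * (s k).length + 2) := by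
  generalize hw : s k = w
  induction w generalizing s with
  | nil =>
    rw [← hw, update_eq_self, hw]
    exact .loop_nil_exit hw rfl (.skip s)
  | cons x w ih =>
    have h := ih (update s k w) (update_self ..)
    rw [update_idem] at h
    refine .mono (.loop_cons hw rfl (.skip _) h) ?_
    rw [List.length_cons]
    omega

theorem update_update_pair {k j : K} (h : k ≠ j) (s : K → List Γ)
    (a b a' b' : List Γ) : update (update (update (update s k a) j b) k a') j b' =
      update (update s k a') j b' := by
  funext i
  by_cases hj : i = j
  · subst hj
    simp
  · by_cases hk : i = k
    · subst hk
      simp [h]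
    · simp [hj, hk]

/-- The body of a loop also runs for the symbol that ends it; hence the halting symbol is moved too.
-/
theorem exec_move {k j : K} (hkj : k ≠ j) {halt : Γ → Bool} {s : K → List Γ} {w v : List Γ} {x : Γ}
    (hs : s k = w ++ x :: v) (hw : ∀ y ∈ w, halt y = false) (hx : halt x = true) :
    Exec (.move k j halt) s (update (update s k v) j (x :: (w.reverse ++ s j)))
      (2 * w.length + 2) := by
  induction w generalizing s with
  | nil =>
    have h := Exec.push j x (update s k v)
    rw [update_of_ne hkj.symm] at h
    exact .loop_cons_exit hs (by simp [hx]) h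
  | cons y w ih =>
    have h := ih (s := update (update s k (w ++ x :: v)) j (y :: s j))
      (by rw [update_of_ne hkj, update_self]) fun z hz => hw z (List.mem_cons_of_mem _ hz)
    rw [update_update_pair hkj, update_self] at h
    have h0 := Exec.push j y (update s k (w ++ x :: v))
    rw [update_of_ne hkj.symm] at h0
    have h1 := Exec.loop_cons (s := s) hs (by simp [hw y]) h0 h
    refine .mono (?_ : Exec _ _ _ _) (?_ : 1 + (2 * w.length + 2) + 1 ≤ _)
    · rw [List.reverse_cons, List.append_assoc]
      exact h1
    · rw [List.length_cons]
      omega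

theorem exec_move_all {k j : K} (hkj : k ≠ j) (s : K → List Γ) :
    Exec (.move k j fun _ => false) s (update (update s k []) j ((s k).reverse ++ s j))
      (2 * (s k).length + 2) := by
  generalize hw : s k = w
  induction w generalizing s with
  | nil =>
    rw [← hw, update_eq_self, hw, List.reverse_nil, List.nil_append, update_eq_self]
    exact .loop_nil_exit hw rfl (.skip s)
  | cons y w ih =>
    have h := ih (update (update s k w) j (y :: s j)) (by rw [update_of_ne hkj, update_self])
    rw [update_update_pair hkj, update_self] at h
    have h0 := Exec.push j y (update s k w)
    rw [update_of_ne hkj.symm] at h0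
    have h1 := Exec.loop_cons (s := s) (p := fun x => x.elim .skip (.push j)) hw rfl h0 h
    refine .mono (?_ : Exec _ _ _ _) (?_ : 1 + (2 * w.length + 2) + 1 ≤ _)
    · rw [List.reverse_cons, List.append_assoc]
      exact h1
    · rw [List.length_cons]
      omega

end Programs

end KSSim

namespace KSSim

open Function

/-! ### The stacks and the printing of formulae -/

/-- The stacks: `A` holds the input and then the clauses, `B` the part of `A` that has been read,
`C` a clause, `U` a literal, and the output is written on `O`; `T` and `P` are auxiliary. -/
inductive Stk where
  | A | B | C | U | T | P | O
deriving DecidableEq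

instance : Fintype Stk := ⟨{.A, .B, .C, .U, .T, .P, .O}, fun k => by cases k <;> decide⟩

/-- One step of a transducer that reads a string from right to left: `δ p x` is what is written in
the state `p` when `x` is read, and the next state. -/
def transStep (δ : Option Sym → Sym → List Sym × Option Sym) (x : Sym)
    (r : Option Sym × List Sym) : Option Sym × List Sym :=
  ((δ r.1 x).2, (δ r.1 x).1 ++ r.2)

namespace Prog

/-- Write the result of a transducer for the string on `k` on top of `j`, where `fin` is what is
written at the end. -/
def trans (k j : Stk) (δ : Option Sym → Sym → List Sym × Option Sym)
    (fin : Option Sym → List Sym) : Prog Stk Sym :=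
  .seq (move k .T fun _ => false) (.seq
    (.loop .T (fun x => x.elim .skip fun x => pop .P fun p =>
      .seq (push k x) (.seq (pushList j (δ p x).1) (pushList .P (δ p x).2.toList)))
      Option.isSome)
    (pop .P fun p => pushList j (fin p)))

end Prog

/-- The string lies reversed on `T`, so popping reads it from right to left. Each symbol is returned
to `k`, which restores that stack, and the images pile up on `j` in the right order. The state is
kept as the only symbol on `P`, `none` being the empty stack. -/
theorem exec_trans_loop {k j : Stk} (hkj : k ≠ j) (hkT : k ≠ .T) (hkP : k ≠ .P) (hjT : j ≠ .T)
    (hjP : j ≠ .P) {δ : Option Sym → Sym → List Sym × Option Sym} {M : ℕ}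
    (hδ : ∀ p x, (δ p x).1.length ≤ M) (v : List Sym) :
    ∀ (s : Stk → List Sym) (p : Option Sym), s .T = v → s .P = p.toList →
    Exec (.loop .T (fun x => x.elim .skip fun x => .pop .P fun p =>
      .seq (.push k x) (.seq (.pushList j (δ p x).1) (.pushList .P (δ p x).2.toList)))
      Option.isSome) s
      (update (update (update (update s .T []) .P
        (v.foldl (fun r x => transStep δ x r) (p, s j)).1.toList) k (v.reverse ++ s k)) j
        (v.foldl (fun r x => transStep δ x r) (p, s j)).2) ((M + 7) * v.length + 2) := by
  induction v with
  | nil =>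
    intro s p hT hP
    have : (update (update (update (update s .T []) .P
        (List.foldl (fun r x => transStep δ x r) (p, s j) []).1.toList) k
        ([].reverse ++ s k)) j (List.foldl (fun r x => transStep δ x r) (p, s j) []).2) = s := by
      rw [List.foldl_nil, ← hP, List.reverse_nil, List.nil_append, ← hT, update_eq_self,
        update_eq_self, update_eq_self, update_eq_self]
    rw [this]
    exact .loop_nil_exit hT rfl (.skip s)
  | cons x v ih =>
    intro s p hT hP
    have e1 : (update s .T v .P).head? = p := by
      rw [update_of_ne (by decide), hP]
      cases p <;> rfl
    have h1 := Exec.push k x (update (update s .T v) .P ((update s .T v) .P).tail)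
    have h2 := exec_pushList j (δ p x).1 (update (update (update s .T v) .P
      ((update s .T v) .P).tail) k (x :: (update (update s .T v) .P ((update s .T v) .P).tail) k))
    have h3 := exec_pushList .P (δ p x).2.toList (update (update (update (update s .T v) .P
      ((update s .T v) .P).tail) k (x :: (update (update s .T v) .P ((update s .T v) .P).tail) k)) j
      ((δ p x).1 ++ (update (update (update s .T v) .P ((update s .T v) .P).tail) k
        (x :: (update (update s .T v) .P ((update s .T v) .P).tail) k)) j))
    have hb : ((update s .T v) .P).tail = [] := by
      rw [update_of_ne (by decide), hP]
      cases p <;> rfl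
    have h4 := Exec.pop (p := fun p => .seq (.push k x) (.seq (.pushList j (δ p x).1)
      (.pushList .P (δ p x).2.toList))) e1 rfl (.seq h1 (.seq h2 h3))
    refine Exec.congr (.loop_cons hT rfl h4 (ih _ (δ p x).2 ?_ ?_)) ?_ ?_
    · simp [hkT.symm, hjT.symm]
    · rw [update_self, update_of_ne hjP.symm, update_of_ne hkP.symm, update_self, hb,
        List.append_nil]
    · funext i
      by_cases hj : i = j
      · subst hj
        simp [transStep, hkj.symm, hjT, hjP]
      · by_cases hk : i = k
        · subst hk
          simp [hkj, hkT, hkP]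
        · by_cases hi : i = .P
          · subst hi
            simp [transStep, hkj.symm, hjT, hjP, hj, hk]
          · by_cases hi' : i = .T
            · subst hi'
              simp [hj, hk]
            · simp [hj, hk, hi, hi']
    · have h7 : (δ p x).2.toList.length ≤ 1 := by cases (δ p x).2 <;> simp
      have h8 := hδ p x
      rw [List.length_cons, Nat.mul_add]
      omega

theorem exec_trans {k j : Stk} (hkj : k ≠ j) (hkT : k ≠ .T) (hkP : k ≠ .P) (hjT : j ≠ .T)
    (hjP : j ≠ .P) {δ : Option Sym → Sym → List Sym × Option Sym} {fin : Option Sym → List Sym}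
    {M : ℕ} (hδ : ∀ p x, (δ p x).1.length ≤ M) (hfin : ∀ p, (fin p).length ≤ M)
    (s : Stk → List Sym) (hT : s .T = []) (hP : s .P = []) :
    Exec (.trans k j δ fin) s (update s j
      (fin ((s k).foldr (transStep δ) (none, s j)).1 ++
        ((s k).foldr (transStep δ) (none, s j)).2)) ((M + 9) * ((s k).length + 1)) := by
  have h1 := exec_move_all hkT s
  rw [hT, List.append_nil] at h1
  have h2 := exec_trans_loop hkj hkT hkP hjT hjP hδ (s k).reverse
    (update (update s k []) .T (s k).reverse) none (by simp) (by simp [hkP.symm, hP])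
  have e : (update (update s k []) .T (s k).reverse) j = s j := by simp [hkj.symm, hjT]
  have e' : (update (update s k []) .T (s k).reverse) k = [] := by simp [hkT]
  rw [List.foldl_reverse, List.reverse_reverse, List.length_reverse, e, e', List.append_nil] at h2
  set r := (s k).foldr (transStep δ) (none, s j)
  set s2 := (update (update (update (update (update (update s k []) .T (s k).reverse) .T []) .P
    r.1.toList) k (s k)) j r.2) with hs2
  have e3 : (s2 .P).head? = r.1 := by
    simp only [hs2, update_of_ne hjP.symm, update_of_ne hkP.symm, update_self]
    cases r.1 <;> rfl
  have e4 : (s2 .P).tail = [] := by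
    simp only [hs2, update_of_ne hjP.symm, update_of_ne hkP.symm, update_self]
    cases r.1 <;> rfl
  have h3 : Exec (.pop .P fun p => .pushList j (fin p)) s2 _ _ :=
    .pop e3 e4 (exec_pushList j (fin r.1) _)
  have h4 := Exec.seq h1 (Exec.seq h2 h3)
  refine Exec.congr (p := .trans k j δ fin) h4 ?_ ?_
  · funext i
    by_cases hj : i = j
    · subst hj
      simp [hs2, hjP]
    · by_cases hk : i = k
      · subst hk
        simp [hs2, hj, hkP]
      · by_cases hi : i = .P
        · subst hi
          simp [hj, hP]
        · by_cases hi' : i = .T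
          · subst hi'
            simp [hs2, hj, hk, hT]
          · simp [hs2, hj, hk, hi, hi']
  · have := hfin r.1
    ring_nf
    omega

namespace Prog

/-- Write the image of the string on `k` under a substitution on top of `j`. -/
def emit (k j : Stk) (g : Sym → List Sym) : Prog Stk Sym :=
  trans k j (fun _ x => (g x, none)) fun _ => []

/-- Write a list of strings on top of `O`. Each of them is given explicitly, or as the image of the
string on a stack under a substitution. -/
def print : List (List Sym ⊕ Stk × (Sym → List Sym)) → Prog Stk Sym
  | [] => .skip
  | i :: l => .seq (print l) (i.elim (pushList .O) fun i => emit i.1 .O i.2)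

end Prog

/-- The string that is written for an item of `Prog.print`. -/
def itemStr (s : Stk → List Sym) : List Sym ⊕ Stk × (Sym → List Sym) → List Sym
  | .inl w => w
  | .inr i => (s i.1).flatMap i.2

theorem foldr_transStep_subst (g : Sym → List Sym) (w o : List Sym) :
    w.foldr (transStep fun _ x => (g x, none)) (none, o) = (none, w.flatMap g ++ o) := by
  induction w with
  | nil => rfl
  | cons x w ih => rw [List.foldr_cons, ih]; simp [transStep]

theorem exec_emit {k j : Stk} (hkj : k ≠ j) (hkT : k ≠ .T) (hkP : k ≠ .P) (hjT : j ≠ .T)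
    (hjP : j ≠ .P) {g : Sym → List Sym} (hg : ∀ x, (g x).length ≤ 10) (s : Stk → List Sym)
    (hT : s .T = []) (hP : s .P = []) :
    Exec (.emit k j g) s (update s j ((s k).flatMap g ++ s j)) (19 * ((s k).length + 1)) := by
  have h := exec_trans hkj hkT hkP hjT hjP (δ := fun _ x => (g x, none)) (fin := fun _ => [])
    (M := 10) (fun _ => hg) (fun _ => Nat.zero_le _) s hT hP
  rw [foldr_transStep_subst] at h
  exact h

/-- Conditions under which an item can be printed. -/
def ItemOk (s : Stk → List Sym) (n : ℕ) : List Sym ⊕ Stk × (Sym → List Sym) → Prop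
  | .inl w => w.length ≤ 10
  | .inr i => i.1 ≠ .T ∧ i.1 ≠ .P ∧ i.1 ≠ .O ∧ (∀ x, (i.2 x).length ≤ 10) ∧ (s i.1).length ≤ n

/-- The items are written last first, since the output is a stack. An item costs at most
$(10+9)(n+1)$ steps by `exec_trans`, where 10 bounds the image of a symbol. -/
theorem exec_print (l : List (List Sym ⊕ Stk × (Sym → List Sym))) (s : Stk → List Sym) (n : ℕ)
    (hl : ∀ i ∈ l, ItemOk s n i) (hT : s .T = []) (hP : s .P = []) :
    Exec (.print l) s (update s .O (l.flatMap (itemStr s) ++ s .O))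
      (l.length * (19 * (n + 1)) + 1) := by
  induction l with
  | nil =>
    refine .mono (m := 1) ?_ (by simp)
    rw [List.flatMap_nil, List.nil_append, update_eq_self]
    exact .skip s
  | cons i l ih =>
    have h1 := ih fun i hi => hl i (List.mem_cons_of_mem _ hi)
    have hi := hl i List.mem_cons_self
    set s1 := update s .O (l.flatMap (itemStr s) ++ s .O) with hs1
    have h2 : Exec (i.elim (Prog.pushList .O) fun i => Prog.emit i.1 .O i.2) s1
        (update s1 .O (itemStr s i ++ s1 .O)) (19 * (n + 1)) := by
      match i, hi with
      | .inl w, hi =>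
        have : w.length ≤ 10 := hi
        exact .mono (p := Prog.pushList Stk.O w) (exec_pushList .O w s1) (by omega)
      | .inr (k, g), ⟨h1, h2, h3, h4, h5⟩ =>
        have h6 := exec_emit h3 h1 h2 (by decide) (by decide) h4 s1 (by simp [hs1, hT])
          (by simp [hs1, hP])
        have e : s1 k = s k := by
          simp only at h3
          simp [hs1, h3]
        simp only [e] at h6
        refine .mono h6 ?_
        simp only at h5
        omega
    refine .mono (m := l.length * (19 * (n + 1)) + 1 + 19 * (n + 1)) ?_ ?_
    · have h3 := Exec.seq h1 h2
      rw [hs1, update_self, update_idem, ← List.append_assoc] at h3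
      exact h3
    · rw [List.length_cons, Nat.add_mul]
      omega

end KSSim

namespace KSSim

open Function

/-! ### Strings -/

/-- The string of a list of clauses without the end marker. -/
def encodeBody (L : List Clause) : List Sym :=
  L.flatMap fun c => c.flatMap encodeLit ++ [Sym.endClause]

theorem encodeClauses_eq (L : List Clause) : encodeClauses L = encodeBody L ++ [.endList] := rfl

theorem encodeBody_cons (c : Clause) (L : List Clause) :
    encodeBody (c :: L) = c.flatMap encodeLit ++ .endClause :: encodeBody L := by
  simp [encodeBody]

theorem encodeBody_append (L M : List Clause) :
    encodeBody (L ++ M) = encodeBody L ++ encodeBody M := by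
  simp [encodeBody]

/-- Duality changes only the sign symbol, so it can be carried out by a substitution of symbols. -/
theorem encodeLit_eq (a : Lit) : ∃ l : List Bool, encodeLit a =
      .sign a.pos :: (l.map .bit ++ [.endLit]) ∧
    encodeLit a.dual = .sign (!a.pos) :: (l.map .bit ++ [.endLit]) :=
  ⟨_, rfl, rfl⟩

/-- The substitution that dualizes a literal. -/
def subDual : Sym → List Sym
  | .sign b => [.sign !b]
  | x => [x]

/-- The substitution that turns a clause into the conjunction of the duals. -/
def subConj : Sym → List Sym
  | .sign b => [.and, .lit, .sign !b]
  | .endClause => [.top]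
  | x => [x]

/-- The substitution that turns a list of clauses into the disjunction of their duals. -/
def subDisj : Sym → List Sym
  | .sign b => [.and, .lit, .sign !b]
  | .endClause => [.top, .or]
  | .endList => [.bot, .bot]
  | x => [x]

/-- The substitution that turns a list of clauses into the derivation of their duals by
weakening. -/
def subWeak : Sym → List Sym
  | .sign b => [.and, .rule .awd, .fm, .bot, .fm, .lit, .sign !b]
  | .endClause => [.fm, .top, .or]
  | .endList => [.fm, .bot, .fm, .bot]
  | x => [x]

theorem length_subDual (x : Sym) : (subDual x).length ≤ 10 := by cases x <;> simp [subDual]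

theorem length_subConj (x : Sym) : (subConj x).length ≤ 10 := by cases x <;> simp [subConj]

theorem length_subDisj (x : Sym) : (subDisj x).length ≤ 10 := by cases x <;> simp [subDisj]

theorem length_subWeak (x : Sym) : (subWeak x).length ≤ 10 := by cases x <;> simp [subWeak]

theorem flatMap_map_bit {g : Sym → List Sym} (hg : ∀ b, g (.bit b) = [.bit b]) (l : List Bool) :
    (l.map Sym.bit).flatMap g = l.map Sym.bit := by
  induction l with
  | nil => rfl
  | cons b l ih => rw [List.map_cons, List.flatMap_cons, hg, ih]; rfl

theorem flatMap_encodeLit {g : Sym → List Sym} {w : List Sym} (hg : ∀ b, g (.bit b) = [.bit b])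
    (hg' : g .endLit = [.endLit]) (hs : ∀ b, g (.sign b) = w ++ [.sign !b]) (a : Lit) :
    (encodeLit a).flatMap g = w ++ encodeLit a.dual := by
  obtain ⟨l, h1, h2⟩ := encodeLit_eq a
  rw [h1, h2, List.flatMap_cons, List.flatMap_append, flatMap_map_bit hg, hs]
  simp [hg']

theorem flatMap_subDual (a : Lit) : (encodeLit a).flatMap subDual = encodeLit a.dual :=
  flatMap_encodeLit (w := []) (fun _ => rfl) rfl (fun _ => rfl) a

theorem flatMap_subConj (c : Clause) :
    (c.flatMap encodeLit ++ [Sym.endClause]).flatMap subConj = encodeFormula (conj c) := by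
  induction c with
  | nil => rfl
  | cons a c ih =>
    rw [List.flatMap_cons, List.append_assoc, List.flatMap_append, ih,
      flatMap_encodeLit (w := [.and, .lit]) (fun _ => rfl) rfl (fun _ => rfl) a]
    rfl

/-- The final units in `conj` and `disj` make this a plain substitution. Every clause end writes the
last $\top$ of its conjunction and the connective of the next disjunction; the list end closes that
disjunction with $\bot,\bot$. Only the first `or` has to be supplied separately. -/
theorem flatMap_subDisj (L : List Clause) :
    .or :: (encodeClauses L).flatMap subDisj = encodeFormula (disj L) := by
  induction L with
  | nil => rfl
  | cons c L ih =>
    have h : (c.flatMap encodeLit ++ [Sym.endClause]).flatMap subDisj =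
        encodeFormula (conj c) ++ [.or] := by
      clear ih
      induction c with
      | nil => rfl
      | cons a c ih =>
        rw [List.flatMap_cons, List.append_assoc, List.flatMap_append, ih,
          flatMap_encodeLit (w := [.and, .lit]) (fun _ => rfl) rfl (fun _ => rfl) a]
        simp [conj, encodeFormula]
    have e : encodeClauses (c :: L) =
        (c.flatMap encodeLit ++ [Sym.endClause]) ++ encodeClauses L := by
      simp [encodeClauses]
    rw [e, List.flatMap_append, h, List.append_assoc, List.singleton_append, ih]
    rfl

theorem flatMap_subWeak (L : List Clause) :
    .or :: (encodeClauses L).flatMap subWeak = encodeDeriv (weakDeriv L) := by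
  induction L with
  | nil => rfl
  | cons c L ih =>
    have h : (c.flatMap encodeLit ++ [Sym.endClause]).flatMap subWeak =
        encodeDeriv (c.foldr (fun x Ψ => .and (.step .awd (.fm .bot) (.fm (.lit x.dual))) Ψ)
          (.fm .top)) ++ [.or] := by
      clear ih
      induction c with
      | nil => rfl
      | cons a c ih =>
        rw [List.flatMap_cons, List.append_assoc, List.flatMap_append, ih,
          flatMap_encodeLit (w := [.and, .rule .awd, .fm, .bot, .fm, .lit]) (fun _ => rfl) rfl
            (fun _ => rfl) a]
        simp [encodeDeriv, encodeFormula]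
    have e : encodeClauses (c :: L) =
        (c.flatMap encodeLit ++ [Sym.endClause]) ++ encodeClauses L := by
      simp [encodeClauses]
    rw [e, List.flatMap_append, h, List.append_assoc, List.singleton_append, ih]
    rfl

/-- The end of the output of `dualTrans`. The states `⊤` and `⊥` mean that the last clause is being
read, and `∧` and `∨` that another clause is; no literal of it has been read in `⊤` and `∧`. -/
def dualFin : Option Sym → List Sym
  | none => [.bot]
  | some .top => [.top]
  | some .and => [.or, .top]
  | some .or => [.or]
  | some _ => []

/-- The transducer that writes the dual of the formula of a list of clauses. -/
def dualTrans : Option Sym → Sym → List Sym × Option Sym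
  | _, .endList => ([], none)
  | none, .endClause => ([], some .top)
  | some p, .endClause => (dualFin (some p), some .and)
  | some .top, .sign b => ([.lit, .sign !b], some .bot)
  | some .bot, .sign b => ([.and, .lit, .sign !b], some .bot)
  | some .and, .sign b => ([.lit, .sign !b], some .or)
  | some .or, .sign b => ([.and, .lit, .sign !b], some .or)
  | p, x => ([x], p)

theorem length_dualFin (p : Option Sym) : (dualFin p).length ≤ 10 := by
  unfold dualFin
  split <;> simp

theorem length_dualTrans (p : Option Sym) (x : Sym) : (dualTrans p x).1.length ≤ 10 := by
  unfold dualTrans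
  split <;> simp [length_dualFin]

theorem foldr_dualTrans_tail (p : Option Sym) (l : List Bool) (o : List Sym) :
    (l.map Sym.bit ++ [Sym.endLit]).foldr (transStep dualTrans) (p, o) =
      (p, l.map Sym.bit ++ .endLit :: o) := by
  have h1 : ∀ o, transStep dualTrans .endLit (p, o) = (p, .endLit :: o) := by
    intro o
    unfold transStep dualTrans
    split <;> simp_all
  have h2 : ∀ b o, transStep dualTrans (.bit b) (p, o) = (p, .bit b :: o) := by
    intro b o
    unfold transStep dualTrans
    split <;> simp_all
  induction l with
  | nil => exact h1 o
  | cons b l ih => rw [List.map_cons, List.cons_append, List.foldr_cons, ih, h2]; rfl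

/-- The two pairs of states, for the last clause and for any other, behave alike on literals.
Reading from the right, the first literal met is the last one of the clause and gets no `and`. -/
theorem foldr_dualTrans_lits (c : Clause) (o : List Sym) :
    (∀ p ∈ [(Sym.top, Sym.bot), (Sym.and, Sym.or)],
      (c.flatMap encodeLit).foldr (transStep dualTrans) (some p.1, o) =
        if c = [] then (some p.1, o) else
          (some p.2, encodeFormula (Formula.bigOr (c.map .lit)).dual ++ o)) := by
  intro p hp
  induction c with
  | nil => rfl
  | cons a c ih =>
    rw [List.flatMap_cons, List.foldr_append, ih, if_neg (List.cons_ne_nil _ _)]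
    obtain ⟨l, h1, h2⟩ := encodeLit_eq a
    rw [h1, List.foldr_cons]
    cases c with
    | nil =>
      rw [if_pos rfl, foldr_dualTrans_tail]
      simp only [List.mem_cons, List.not_mem_nil, or_false] at hp
      rcases hp with rfl | rfl <;>
        simp [transStep, dualTrans, Formula.bigOr, Formula.dual, encodeFormula, h2]
    | cons b c =>
      rw [if_neg (List.cons_ne_nil _ _), foldr_dualTrans_tail]
      simp only [List.mem_cons, List.not_mem_nil, or_false] at hp
      rcases hp with rfl | rfl <;>
        simp [transStep, dualTrans, Formula.bigOr, Formula.dual, encodeFormula, h2]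

/-- Whether a clause is empty is known only once its left end is reached, so what precedes it is
written at the next `endClause` or by `dualFin`. The invariant therefore includes this pending
output. The state `none` tells that no clause lies to the right, so that the next one is the last
and gets no `or`. -/
theorem foldr_dualTrans (Γ : List Clause) (o : List Sym) :
    dualFin ((encodeClauses Γ).foldr (transStep dualTrans) (none, o)).1 ++
        ((encodeClauses Γ).foldr (transStep dualTrans) (none, o)).2 =
      encodeFormula (cnf Γ).dual ++ o ∧
    (((encodeClauses Γ).foldr (transStep dualTrans) (none, o)).1 = none ↔ Γ = []) := by
  induction Γ with
  | nil => exact ⟨rfl, by simp [encodeClauses, transStep, dualTrans]⟩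
  | cons c Γ ih =>
    have e : encodeClauses (c :: Γ) =
        c.flatMap encodeLit ++ .endClause :: encodeClauses Γ := by
      simp [encodeClauses]
    rw [e, List.foldr_append, List.foldr_cons]
    obtain ⟨h1, h2⟩ := ih
    generalize (encodeClauses Γ).foldr (transStep dualTrans) (none, o) = r at h1 h2
    obtain ⟨p, w⟩ := r
    cases Γ with
    | nil =>
      obtain rfl : p = none := h2.2 rfl
      have h3 : w = o := by simpa [dualFin, cnf, Formula.bigAnd, Formula.dual, encodeFormula] using h1
      subst h3
      have h4 := foldr_dualTrans_lits c w (.top, .bot) (by simp)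
      have h5 : transStep dualTrans .endClause (none, w) = (some .top, w) := rfl
      rw [h5, h4]
      cases c with
      | nil => exact ⟨rfl, by simp⟩
      | cons a c => exact ⟨rfl, by simp⟩
    | cons d Γ =>
      cases p with
      | none => exact absurd (h2.1 rfl) (List.cons_ne_nil _ _)
      | some p =>
        have h4 := foldr_dualTrans_lits c (encodeFormula (cnf (d :: Γ)).dual ++ o) (.and, .or)
          (by simp)
        have h5 : transStep dualTrans .endClause (some p, w) =
            (some .and, encodeFormula (cnf (d :: Γ)).dual ++ o) := by
          rw [← h1]
          rfl
        have h6 : encodeFormula (cnf (c :: d :: Γ)).dual =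
            .or :: (encodeFormula (Formula.bigOr (c.map .lit)).dual ++
              encodeFormula (cnf (d :: Γ)).dual) := rfl
        rw [h5, h4, h6]
        cases c with
        | nil => exact ⟨rfl, by simp⟩
        | cons a c => exact ⟨by simp [dualFin], by simp⟩

end KSSim

/-! ### Explicit stack configurations. -/

namespace KSSim

open Function

/-- The contents of the stacks. -/
def st (a b c u t p o : List Sym) : Stk → List Sym
  | .A => a
  | .B => b
  | .C => c
  | .U => u
  | .T => t
  | .P => p
  | .O => o

section

variable (a b c u t p o w : List Sym)

@[simp] theorem update_st_A : update (st a b c u t p o) .A w = st w b c u t p o := by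
  funext i; cases i <;> rfl

@[simp] theorem update_st_B : update (st a b c u t p o) .B w = st a w c u t p o := by
  funext i; cases i <;> rfl

@[simp] theorem update_st_C : update (st a b c u t p o) .C w = st a b w u t p o := by
  funext i; cases i <;> rfl

@[simp] theorem update_st_U : update (st a b c u t p o) .U w = st a b c w t p o := by
  funext i; cases i <;> rfl

@[simp] theorem update_st_T : update (st a b c u t p o) .T w = st a b c u w p o := by
  funext i; cases i <;> rfl

@[simp] theorem update_st_O : update (st a b c u t p o) .O w = st a b c u t p w := by
  funext i; cases i <;> rfl

@[simp] theorem st_A : st a b c u t p o .A = a := rfl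
@[simp] theorem st_B : st a b c u t p o .B = b := rfl
@[simp] theorem st_C : st a b c u t p o .C = c := rfl
@[simp] theorem st_U : st a b c u t p o .U = u := rfl
@[simp] theorem st_T : st a b c u t p o .T = t := rfl
@[simp] theorem st_O : st a b c u t p o .O = o := rfl

theorem exec_push_A (x : Sym) : Exec (.push .A x) (st a b c u t p o)
    (st (x :: a) b c u t p o) 1 := by
  simpa using Exec.push .A x (st a b c u t p o)

theorem exec_push_B (x : Sym) : Exec (.push .B x) (st a b c u t p o)
    (st a (x :: b) c u t p o) 1 := by
  simpa using Exec.push .B x (st a b c u t p o)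

theorem exec_push_C (x : Sym) : Exec (.push .C x) (st a b c u t p o)
    (st a b (x :: c) u t p o) 1 := by
  simpa using Exec.push .C x (st a b c u t p o)

theorem exec_push_U (x : Sym) : Exec (.push .U x) (st a b c u t p o)
    (st a b c (x :: u) t p o) 1 := by
  simpa using Exec.push .U x (st a b c u t p o)

end

/-! ### Searching a literal -/

/-- The symbol is not a sign. -/
def notSign : Sym → Bool
  | .sign _ => false
  | _ => true

theorem notSign_of_mem_bits {l : List Bool} {x : Sym}
    (hx : x ∈ l.map Sym.bit ++ [Sym.endLit]) : notSign x = true := by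
  simp only [List.mem_append, List.mem_map, List.mem_singleton] at hx
  rcases hx with ⟨b, -, rfl⟩ | rfl <;> rfl

/-- The symbol is a bit or an end marker of a literal or a clause. -/
def plain : Sym → Bool
  | .bit _ => true
  | .endLit => true
  | .endClause => true
  | _ => false

theorem plain_of_mem_bits {l : List Bool} {x : Sym}
    (hx : x ∈ l.map Sym.bit ++ [Sym.endLit]) : plain x = true := by
  simp only [List.mem_append, List.mem_map, List.mem_singleton] at hx
  rcases hx with ⟨b, -, rfl⟩ | rfl <;> rfl

namespace Prog

/-- Compare the symbol `z` of `U` with the next symbol of `A`, and push a mark on `U` if the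
comparison of literals is finished. -/
def compareNext (z : Sym) : Option Sym → Prog Stk Sym
  | none => .skip
  | some y => .seq (.push .B y)
      (if y = z then (if z = .endLit then .push .U .top else .skip) else .push .U .bot)

/-- The body of the loop that compares the literals on `U` and `A`. If they are equal then the
literal, which has been moved from `A` to `B`, is removed, and a mark is pushed on `A`. -/
def compareBody : Option Sym → Prog Stk Sym
  | none => .skip
  | some z => if z = .top then
      .seq (.loop .B (fun _ => .skip) fun x => x.elim false notSign) (.push .A .top)
    else if z = .bot then .skip
    else .seq (.push .T z) (.pop .A (compareNext z))

/-- Compare the literals on `U` and `A`. -/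
def compareLit : Prog Stk Sym :=
  .seq (.loop .U compareBody fun z => z.elim false fun z => z != .top && z != .bot)
    (.move .T .U fun _ => false)

/-- The body of the loop that searches the literal on `U` in the clauses on `A`. -/
def findBody (found missing : Prog Stk Sym) : Option Sym → Prog Stk Sym
  | some (.sign b) => .seq (.push .A (.sign b)) compareLit
  | some .top => found
  | some .endList => missing
  | some x => .push .B x
  | none => .skip

/-- The loop that searches a literal goes on for this symbol of `A`. -/
def findCont : Option Sym → Bool
  | some (.sign _) => true
  | some (.bit _) => true
  | some .endLit => true
  | some .endClause => true
  | _ => false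

/-- Search the literal on `U` in the clauses on `A`. -/
def findLit (found missing : Prog Stk Sym) : Prog Stk Sym :=
  .loop .A (findBody found missing) findCont

end Prog

open Prog

theorem exec_loop_skip {k : Stk} {f : Option Sym → Bool} {w v : List Sym} {x : Sym}
    (hw : ∀ y ∈ w, f (some y) = true) (hx : f (some x) = false) {s : Stk → List Sym}
    (hs : s k = w ++ x :: v) :
    Exec (.loop k (fun _ => .skip) f) s (update s k v) (2 * w.length + 2) := by
  induction w generalizing s with
  | nil => exact .loop_cons_exit hs hx (.skip _)
  | cons y w ih =>
    have h := ih (fun z hz => hw z (List.mem_cons_of_mem _ hz))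
      (s := update s k (w ++ x :: v)) (update_self ..)
    rw [update_idem] at h
    refine .mono (.loop_cons hs (hw y List.mem_cons_self) (.skip _) h) ?_
    rw [List.length_cons]
    omega

section

variable {b c p o : List Sym}

/-- While the symbols agree, those of `U` are saved on `T`, from which the literal is restored, and
those of `A` pass to `B`. -/
theorem exec_compare_prefix {q l m t : List Sym} {fin : Stk → List Sym} {n : ℕ}
    (hq : ∀ z ∈ q, z ≠ .top ∧ z ≠ .bot ∧ z ≠ .endLit)
    (h : Exec (.loop .U compareBody fun z => z.elim false fun z => z != .top && z != .bot)
      (st m (q.reverse ++ b) c l (q.reverse ++ t) p o) fin n) :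
    Exec (.loop .U compareBody fun z => z.elim false fun z => z != .top && z != .bot)
      (st (q ++ m) b c (q ++ l) t p o) fin (n + 5 * q.length) := by
  induction q generalizing b t with
  | nil => exact h
  | cons z q ih =>
    have h1 := ih (b := z :: b) (t := z :: t) (fun y hy => hq y (List.mem_cons_of_mem _ hy))
      (by simpa using h)
    obtain ⟨hz1, hz2, hz3⟩ := hq z List.mem_cons_self
    refine .mono (.loop_cons (m := 4) (x := z) (w := q ++ l) rfl (by simp [hz1, hz2]) ?_ h1) ?_
    · simp only [compareBody, hz1, hz2, if_false, update_st_U]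
      refine .mono (.seq (.push _ _ _) (Exec.pop (o := some z) (t := q ++ m) (m := 2) rfl rfl ?_))
        le_rfl
      simp only [compareNext, hz3, if_true, if_false, update_st_A, update_st_T, st_T]
      refine .seq (m := 1) (n := 1) (.push _ _ _) ?_
      simpa using Exec.skip _
    · rw [List.length_cons]
      omega

theorem exec_compare_ne {l m t : List Sym} {y z : Sym} (hyz : y ≠ z) (hz1 : z ≠ .top)
    (hz2 : z ≠ .bot) :
    Exec (.loop .U compareBody fun z => z.elim false fun z => z != .top && z != .bot)
      (st (y :: m) b c (z :: l) t p o) (st m (y :: b) c l (z :: t) p o) 7 := by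
  refine .loop_cons (m := 4) (n := 2) (s' := st m (y :: b) c (.bot :: l) (z :: t) p o) (x := z)
    (w := l) rfl (by simp [hz1, hz2]) ?_ ?_
  · simp only [compareBody, hz1, hz2, if_false, update_st_U]
    refine .mono (.seq (.push _ _ _) (Exec.pop (o := some y) (t := m) (m := 2) rfl rfl ?_)) le_rfl
    simp only [compareNext, hyz, if_false, update_st_A, update_st_T, st_T]
    refine .seq (m := 1) (n := 1) (.push _ _ _) ?_
    simpa using Exec.push .U Sym.bot (st m (y :: b) c l (z :: t) p o)
  · refine .loop_cons_exit (m := 1) (x := .bot) (w := l) rfl rfl ?_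
    simpa [compareBody] using Exec.skip (st m (y :: b) c l (z :: t) p o)

theorem exec_compare_eq {q m t : List Sym} {s : Bool} (hq : ∀ z ∈ q, notSign z = true) :
    Exec (.loop .U compareBody fun z => z.elim false fun z => z != .top && z != .bot)
      (st (.endLit :: m) (q ++ .sign s :: b) c [.endLit] t p o)
      (st (.top :: m) b c [] (.endLit :: t) p o) (2 * q.length + 11) := by
  have h1 : Exec (compareBody (some .endLit)) (st (.endLit :: m) (q ++ .sign s :: b) c [] t p o)
      (st m (.endLit :: q ++ .sign s :: b) c [.top] (.endLit :: t) p o) 4 := by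
    refine .mono (.seq (.push _ _ _) (Exec.pop (o := some .endLit) (t := m) (m := 2) rfl rfl ?_))
      le_rfl
    simp only [compareNext, if_true, update_st_A, update_st_T, st_T]
    refine .seq (m := 1) (n := 1) (.push _ _ _) ?_
    simpa using Exec.push .U Sym.top
      (st m (.endLit :: (q ++ .sign s :: b)) c [] (.endLit :: t) p o)
  have h2 : Exec (.loop .B (fun _ => .skip) fun x => x.elim false notSign)
      (st m (.endLit :: q ++ .sign s :: b) c [] (.endLit :: t) p o)
      (st m b c [] (.endLit :: t) p o) (2 * (q.length + 1) + 2) := by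
    have := exec_loop_skip (k := .B) (f := fun x => x.elim false notSign) (w := .endLit :: q)
      (x := .sign s) (v := b) (by simpa [notSign] using hq) rfl
      (s := st m (.endLit :: q ++ .sign s :: b) c [] (.endLit :: t) p o) rfl
    simpa using this
  have h3 : Exec (compareBody (some .top))
      (st m (.endLit :: q ++ .sign s :: b) c [] (.endLit :: t) p o)
      (st (.top :: m) b c [] (.endLit :: t) p o) (2 * (q.length + 1) + 2 + 1) := by
    refine .seq h2 ?_
    simpa using Exec.push .A Sym.top (st m b c [] (.endLit :: t) p o)
  refine .mono (.loop_cons (m := 4) (x := .endLit) (w := [])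
    (s' := st m (.endLit :: q ++ .sign s :: b) c [.top] (.endLit :: t) p o) rfl rfl ?_
    (.loop_cons_exit (m := 2 * (q.length + 1) + 2 + 1) (x := .top) (w := []) rfl rfl ?_)) ?_
  · simpa using h1
  · simpa using h3
  · omega

theorem exec_compareLit_eq (u : Lit) (w : List Sym) :
    Exec compareLit (st (encodeLit u ++ w) b c (encodeLit u) [] p o)
      (st (.top :: w) b c (encodeLit u) [] p o) (9 * (encodeLit u).length + 10) := by
  obtain ⟨l, h1, -⟩ := encodeLit_eq u
  have h2 := exec_compare_eq (q := (l.map Sym.bit).reverse) (s := u.pos) (m := w) (b := b) (c := c)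
    (t := (.sign u.pos :: l.map Sym.bit).reverse) (p := p) (o := o)
    (fun z hz => notSign_of_mem_bits (List.mem_append_left _ (List.mem_reverse.1 hz)))
  have h3 := exec_compare_prefix (q := .sign u.pos :: l.map Sym.bit) (l := [.endLit])
    (m := .endLit :: w) (t := []) (b := b) (fun z hz => by
      simp only [List.mem_cons, List.mem_map] at hz
      rcases hz with rfl | ⟨b, -, rfl⟩ <;> simp) (by simpa using h2)
  have h4 := exec_move_all (k := .T) (j := .U) (by decide)
    (st (.top :: w) b c [] (.endLit :: (.sign u.pos :: l.map Sym.bit).reverse) p o)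
  refine Exec.congr (.seq (.mono (n := 7 * l.length + 16) (m := 2 * l.length + 11 + 5 * (l.length + 1))
    ?_ (by omega)) h4) ?_ ?_
  · simpa [h1] using h3
  · simp [h1]
  · simp [h1]
    omega

theorem exists_common_prefix {α : Type} : ∀ {l m : List α}, ¬ l <+: m → ¬ m <+: l →
    ∃ q y z l' m', l = q ++ y :: l' ∧ m = q ++ z :: m' ∧ y ≠ z
  | [], m, h, _ => absurd List.nil_prefix h
  | _ :: _, [], _, h => absurd List.nil_prefix h
  | x :: l, y :: m, h, h' => by
    by_cases hxy : x = y
    · subst hxy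
      obtain ⟨q, y, z, l', m', rfl, rfl, h3⟩ := exists_common_prefix
        (l := l) (m := m) (fun h1 => h (by simpa using h1)) fun h1 => h' (by simpa using h1)
      exact ⟨x :: q, y, z, l', m', rfl, rfl, h3⟩
    · exact ⟨[], x, y, l, m, rfl, rfl, hxy⟩

theorem not_encodeLit_prefix {x u : Lit} (h : x ≠ u) : ¬ encodeLit x <+: encodeLit u := by
  rintro ⟨s, hs⟩
  exact h (encodeLit_prefix (t := []) (by simpa using hs)).1

/-- Codes of distinct literals are not prefixes of each other, so there is a first disagreement. The
comparison stops there, inside the literal; the unread rest has no sign symbol, and the search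
passes over it without starting another comparison. -/
theorem exec_compareLit_ne {x u : Lit} (hxu : x ≠ u) (w : List Sym) :
    ∃ r m, encodeLit x = r ++ m ∧ r ≠ [] ∧ (∀ y ∈ m, plain y = true) ∧
      Exec compareLit (st (encodeLit x ++ w) b c (encodeLit u) [] p o)
        (st (m ++ w) (r.reverse ++ b) c (encodeLit u) [] p o) (7 * r.length + 10) := by
  obtain ⟨q, y, z, m, l, h1, h2, hyz⟩ := exists_common_prefix
    (not_encodeLit_prefix hxu) (not_encodeLit_prefix hxu.symm)
  have hsym : ∀ (a : Lit), ∀ y ∈ encodeLit a, y ≠ .top ∧ y ≠ .bot := by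
    intro a y hy
    simp only [encodeLit, List.mem_cons, List.mem_append, List.mem_map, List.not_mem_nil,
      or_false] at hy
    rcases hy with rfl | ⟨b, -, rfl⟩ | rfl <;> simp
  have hq : ∀ y ∈ q, y ≠ .top ∧ y ≠ .bot ∧ y ≠ .endLit := by
    intro y hy
    obtain ⟨h3, h4⟩ := hsym x y (by rw [h1]; simp [hy])
    -- The end marker is the last symbol of a code, and `q` is a proper prefix.
    refine ⟨h3, h4, ?_⟩
    rintro rfl
    obtain ⟨l', h5, -⟩ := encodeLit_eq x
    have h6 := congrArg List.dropLast (h1.symm.trans h5)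
    rw [List.dropLast_append_of_ne_nil (List.cons_ne_nil _ _), ← List.cons_append,
      List.dropLast_concat] at h6
    have h7 : Sym.endLit ∈ Sym.sign x.pos :: l'.map Sym.bit := h6 ▸ List.mem_append_left _ hy
    simp at h7
  have hm : ∀ y ∈ m, plain y = true := by
    obtain ⟨l', h3, -⟩ := encodeLit_eq x
    intro y' hy'
    rw [h1] at h3
    cases q with
    | nil =>
      simp only [List.nil_append, List.cons.injEq] at h3
      exact plain_of_mem_bits (h3.2 ▸ hy')
    | cons a q =>
      simp only [List.cons_append, List.cons.injEq] at h3
      exact plain_of_mem_bits (l := l') (h3.2 ▸ by simp [hy'])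
  obtain ⟨hz1, hz2⟩ := hsym u z (by rw [h2]; simp)
  refine ⟨q ++ [y], m, by simp [h1], by simp, hm, ?_⟩
  have h3 := exec_compare_prefix (b := b) (t := []) hq
    (exec_compare_ne (m := m ++ w) (l := l) (b := q.reverse ++ b) (t := q.reverse ++ []) (c := c)
      (p := p) (o := o) hyz hz1 hz2)
  have h4 := exec_move_all (k := .T) (j := .U) (by decide)
    (st (m ++ w) (y :: (q.reverse ++ b)) c l (z :: q.reverse) p o)
  refine Exec.congr (.seq (.mono (n := 7 + 5 * q.length) ?_ le_rfl) h4) ?_ ?_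
  · simpa [h1, h2] using h3
  · simp [h2]
  · simp
    omega

end

end KSSim

namespace KSSim

open Function Prog

section

variable {b c p o : List Sym} {u : Lit} {found missing : Prog Stk Sym} {fin : Stk → List Sym}
  {n : ℕ}

theorem exec_findLit_plain {w v : List Sym} {u' : List Sym} (hw : ∀ y ∈ w, plain y = true)
    (h : Exec (findLit found missing) (st v (w.reverse ++ b) c u' [] p o) fin n) :
    Exec (findLit found missing) (st (w ++ v) b c u' [] p o) fin (n + 2 * w.length) := by
  induction w generalizing b with
  | nil => exact h
  | cons y w ih =>
    have h1 := ih (b := y :: b) (fun z hz => hw z (List.mem_cons_of_mem _ hz)) (by simpa using h)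
    have hy := hw y List.mem_cons_self
    have e : findBody found missing (some y) = .push .B y ∧ findCont (some y) = true := by
      cases y <;> first | exact ⟨rfl, rfl⟩ | simp [plain] at hy
    refine .mono (.loop_cons (m := 1) (x := y) (w := w ++ v) rfl e.2 ?_ h1) ?_
    · rw [e.1, update_st_A]
      exact exec_push_B ..
    · rw [List.length_cons]
      omega

theorem exec_findLit_ne {x : Lit} {v : List Sym} (hxu : x ≠ u)
    (h : Exec (findLit found missing) (st v ((encodeLit x).reverse ++ b) c (encodeLit u) [] p o)
      fin n) :
    Exec (findLit found missing) (st (encodeLit x ++ v) b c (encodeLit u) [] p o) fin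
      (n + 20 * (encodeLit x).length) := by
  obtain ⟨r, m, h1, h2, h3, h4⟩ := exec_compareLit_ne (b := b) (c := c) (p := p) (o := o) hxu v
  have h5 := exec_findLit_plain (v := v) (b := r.reverse ++ b) (u' := encodeLit u) h3
    (by simpa [h1] using h)
  -- At least one symbol is consumed, and it pays for the constant overhead of the comparison.
  have h6 : 1 ≤ r.length := List.length_pos_iff.2 h2
  refine .mono (.loop_cons (m := 1 + (7 * r.length + 10)) (x := .sign x.pos)
    (w := (encodeLit x).tail ++ v) rfl rfl (.seq ?_ h4) h5) ?_
  · rw [update_st_A]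
    exact exec_push_A ..
  · rw [h1, List.length_append]
    omega

theorem exec_findLit_lits {d : Clause} {v : List Sym} (hd : u ∉ d)
    (h : Exec (findLit found missing)
      (st v ((d.flatMap encodeLit).reverse ++ b) c (encodeLit u) [] p o) fin n) :
    Exec (findLit found missing) (st (d.flatMap encodeLit ++ v) b c (encodeLit u) [] p o) fin
      (n + 20 * (d.flatMap encodeLit).length) := by
  induction d generalizing b with
  | nil => exact h
  | cons x d ih =>
    rw [List.mem_cons, not_or] at hd
    have h1 := ih (b := (encodeLit x).reverse ++ b) hd.2 (by simpa using h)
    have h2 := exec_findLit_ne (Ne.symm hd.1) h1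
    refine .mono (m := _) ?_ (?_ : n + 20 * (d.flatMap encodeLit).length +
      20 * (encodeLit x).length ≤ _)
    · simpa using h2
    · rw [List.flatMap_cons, List.length_append]
      omega

theorem exec_findLit_body {L : List Clause} {v : List Sym} (hL : ∀ d ∈ L, u ∉ d)
    (h : Exec (findLit found missing) (st v ((encodeBody L).reverse ++ b) c (encodeLit u) [] p o)
      fin n) :
    Exec (findLit found missing) (st (encodeBody L ++ v) b c (encodeLit u) [] p o) fin
      (n + 20 * (encodeBody L).length) := by
  induction L generalizing b with
  | nil => exact h
  | cons d L ih =>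
    rw [encodeBody_cons] at h ⊢
    have h1 := ih (b := .endClause :: ((d.flatMap encodeLit).reverse ++ b))
      (fun e he => hL e (List.mem_cons_of_mem _ he)) (by simpa using h)
    have h2 := exec_findLit_plain (w := [.endClause]) (by simp [plain]) h1
    have h3 := exec_findLit_lits (hL d List.mem_cons_self) h2
    refine .mono (m := _) ?_ (?_ : n + 20 * (encodeBody L).length + 2 * [Sym.endClause].length +
      20 * (d.flatMap encodeLit).length ≤ _)
    · simpa using h3
    · simp only [List.length_append, List.length_cons, List.length_nil]
      omega

/-- A successful comparison deletes the found occurrence from `B`, so `found` starts exactly at the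
gap it leaves in its clause. -/
theorem exec_findLit_eq {w : List Sym}
    (h : Exec found (st w b c (encodeLit u) [] p o) fin n) :
    Exec (findLit found missing) (st (encodeLit u ++ w) b c (encodeLit u) [] p o) fin
      (n + 9 * (encodeLit u).length + 14) := by
  refine .mono (.loop_cons (m := 1 + (9 * (encodeLit u).length + 10)) (n := n + 1)
    (s' := st (.top :: w) b c (encodeLit u) [] p o)
    (x := .sign u.pos) (w := (encodeLit u).tail ++ w) rfl rfl
    (.seq ?_ (exec_compareLit_eq u w)) ?_) (by omega)
  · rw [update_st_A]
    exact exec_push_A ..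
  · refine .loop_cons_exit (x := .top) (w := w) rfl rfl ?_
    rw [update_st_A]
    exact h

theorem exec_findLit_missing {w u' : List Sym}
    (h : Exec missing (st w b c u' [] p o) fin n) :
    Exec (findLit found missing) (st (.endList :: w) b c u' [] p o) fin (n + 1) := by
  refine .loop_cons_exit (x := .endList) (w := w) rfl rfl ?_
  rw [update_st_A]
  exact h

end

/-! ### The steps of unit propagation -/

namespace Prog

/-- The items of the string of `dropDeriv`. -/
def dropItems : List (List Sym ⊕ Stk × (Sym → List Sym)) :=
  [.inl [.rule .eq, .or, .fm, .or], .inr (.A, subDisj),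
    .inl [.rule .awd, .fm, .bot, .fm, .lit], .inr (.U, fun x => [x])]

/-- Drop the unit clause on `U`. -/
def dropUnit : Prog Stk Sym :=
  .seq (.push .A .endList) (.seq (.move .B .A fun _ => false) (.seq (.print dropItems) (.clear .U)))

/-- The body of the loop that moves a clause from `B` to `C`. -/
def gatherBody : Option Sym → Prog Stk Sym
  | some .endClause => .push .B .endClause
  | some x => .push .C x
  | none => .skip

/-- Move the clause on `B`, to which the rest of it on `A` is added, to `C`. -/
def gather : Prog Stk Sym :=
  .seq (.move .A .B fun x => x == .endClause) (.seq (.pop .B fun _ => .push .C .endClause)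
    (.loop .B gatherBody fun x => x.elim false fun x => x != .endClause))

/-- The items of the string of `resDeriv`. -/
def resItems : List (List Sym ⊕ Stk × (Sym → List Sym)) :=
  [.inl [.rule .eq, .or, .or, .fm, .lit], .inr (.U, fun x => [x]), .inl [.fm, .or],
    .inr (.A, subDisj), .inl [.rule .swi, .and, .fm], .inr (.C, subConj),
    .inl [.rule .aid, .fm, .top, .fm, .or, .lit], .inr (.U, subDual), .inl [.lit],
    .inr (.U, fun x => [x]), .inl [.fm, .or, .and], .inr (.C, subConj), .inl [.lit],
    .inr (.U, subDual), .inl [.lit], .inr (.U, fun x => [x]),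
    .inl [.rule .eq, .or, .or, .fm, .and], .inr (.C, subConj), .inl [.lit], .inr (.U, subDual),
    .inl [.fm, .or], .inr (.A, subDisj), .inl [.rule .acd, .fm, .or, .lit],
    .inr (.U, fun x => [x]), .inl [.lit], .inr (.U, fun x => [x]), .inl [.fm, .lit],
    .inr (.U, fun x => [x])]

/-- Resolve the clause that contains the literal on `U`. -/
def resolveUnit : Prog Stk Sym :=
  .seq gather (.seq (.move .B .A fun _ => false) (.seq (.print resItems)
    (.seq (.push .A .endClause) (.seq (.emit .U .A subDual) (.seq (.emit .C .A fun x => [x])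
      (.seq (.clear .U) (.clear .C)))))))

end Prog

theorem exec_dropUnit {u : Lit} {L : List Clause} {D : Deriv} {N : ℕ}
    (hL : (encodeClauses L).length ≤ N) (hu : (encodeLit u).length ≤ N) :
    Exec dropUnit (st [] (encodeBody L).reverse [] (encodeLit u) [] [] (encodeDeriv D))
      (st (encodeClauses L) [] [] [] [] [] (encodeDeriv (dropDeriv u L D))) (100 * (N + 1)) := by
  have h1 := exec_move_all (k := Stk.B) (j := .A) (by decide)
    (st [.endList] (encodeBody L).reverse [] (encodeLit u) [] [] (encodeDeriv D))
  have hi : ∀ i ∈ dropItems,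
      ItemOk (st (encodeClauses L) [] [] (encodeLit u) [] [] (encodeDeriv D)) N i := by
    simp [dropItems, ItemOk, length_subDisj, hL, hu]
  have h2 := exec_print dropItems
    (st (encodeClauses L) [] [] (encodeLit u) [] [] (encodeDeriv D)) N hi rfl rfl
  have h3 := exec_clear .U (st (encodeClauses L) [] [] (encodeLit u) [] []
    (encodeDeriv (dropDeriv u L D)))
  have e : (encodeBody L).length + 1 = (encodeClauses L).length := by simp [encodeClauses_eq]
  have h4 : ((encodeBody L).reverse.reverse ++ [.endList]) = encodeClauses L := by
    rw [List.reverse_reverse]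
    rfl
  have h5 : dropItems.flatMap (itemStr
      (st (encodeClauses L) [] [] (encodeLit u) [] [] (encodeDeriv D))) ++ encodeDeriv D =
      encodeDeriv (dropDeriv u L D) := by
    simp [itemStr, dropItems, dropDeriv, encodeDeriv, encodeFormula, ← flatMap_subDisj]
  rw [update_st_B, update_st_A, st_B, st_A, h4, List.length_reverse] at h1
  rw [update_st_O, st_O, h5] at h2
  rw [update_st_U, st_U] at h3
  rw [show dropItems.length = 4 from rfl] at h2
  refine .mono (.seq (exec_push_A ..) (.seq h1 (.seq h2 h3))) ?_
  omega

theorem exec_gather_loop {a c u o w v : List Sym} (hw : ∀ x ∈ w, x ≠ .endClause)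
    (hv : v = [] ∨ ∃ v', v = .endClause :: v') :
    Exec (.loop .B gatherBody fun x => x.elim false fun x => x != .endClause)
      (st a (w ++ v) c u [] [] o) (st a v (w.reverse ++ c) u [] [] o) (2 * w.length + 2) := by
  induction w generalizing c with
  | nil =>
    rcases hv with rfl | ⟨v, rfl⟩
    · exact .loop_nil_exit rfl rfl (.skip _)
    · refine .loop_cons_exit (x := .endClause) (w := v) rfl rfl ?_
      rw [update_st_B]
      exact exec_push_B ..
  | cons x w ih =>
    have h := ih (c := x :: c) fun y hy => hw y (List.mem_cons_of_mem _ hy)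
    have hx := hw x List.mem_cons_self
    have e : gatherBody (some x) = .push .C x := by
      cases x <;> first | rfl | exact absurd rfl hx
    refine Exec.congr (.loop_cons (m := 1) (x := x) (w := w ++ v) rfl (by simpa using hx) ?_ h) ?_ ?_
    · rw [e, update_st_B]
      exact exec_push_C ..
    · simp
    · rw [List.length_cons]
      omega

theorem ne_endClause_of_mem {c : Clause} {x : Sym} (hx : x ∈ c.flatMap encodeLit) :
    x ≠ .endClause := by
  obtain ⟨a, -, h⟩ := List.mem_flatMap.1 hx
  simp only [encodeLit, List.mem_cons, List.mem_append, List.mem_map, List.not_mem_nil,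
    or_false] at h
  rcases h with rfl | ⟨b, -, rfl⟩ | rfl <;> simp

/-- The left end of a clause on `B` is recognized by the end marker of the preceding clause or by
the bottom of the stack. -/
theorem encodeBody_reverse (L : List Clause) :
    (encodeBody L).reverse = [] ∨ ∃ v, (encodeBody L).reverse = .endClause :: v := by
  induction L using List.reverseRecOn with
  | nil => exact Or.inl rfl
  | append_singleton L c => exact Or.inr ⟨_, by simp [encodeBody]; rfl⟩

theorem exec_gather (p q : Clause) (L : List Clause) (w u o : List Sym) :
    Exec gather (st (q.flatMap encodeLit ++ .endClause :: w)
      ((p.flatMap encodeLit).reverse ++ (encodeBody L).reverse) [] u [] [] o)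
      (st w (encodeBody L).reverse ((p ++ q).flatMap encodeLit ++ [.endClause]) u [] [] o)
      (4 * ((p ++ q).flatMap encodeLit).length + 6) := by
  have h1 := exec_move (k := Stk.A) (j := .B) (by decide) (halt := fun x => x == .endClause)
    (s := st (q.flatMap encodeLit ++ .endClause :: w)
      ((p.flatMap encodeLit).reverse ++ (encodeBody L).reverse) [] u [] [] o)
    (x := .endClause) rfl (fun y hy => by simpa using ne_endClause_of_mem hy) rfl
  have h2 := exec_gather_loop (a := w) (c := [.endClause]) (u := u) (o := o)
    (w := ((p ++ q).flatMap encodeLit).reverse)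
    (fun x hx => ne_endClause_of_mem (List.mem_reverse.1 hx)) (encodeBody_reverse L)
  have h3 : Exec (.pop .B fun _ => .push .C .endClause)
      (st w (.endClause :: (((p ++ q).flatMap encodeLit).reverse ++ (encodeBody L).reverse)) [] u
        [] [] o)
      (st w (((p ++ q).flatMap encodeLit).reverse ++ (encodeBody L).reverse) [.endClause] u [] []
        o) 2 := by
    refine Exec.pop (m := 1) rfl rfl ?_
    rw [update_st_B]
    exact exec_push_C ..
  have e : (q.flatMap encodeLit).reverse ++
      ((p.flatMap encodeLit).reverse ++ (encodeBody L).reverse) =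
      ((p ++ q).flatMap encodeLit).reverse ++ (encodeBody L).reverse := by simp
  rw [update_st_A, update_st_B, st_B, e] at h1
  rw [List.reverse_reverse, List.length_reverse] at h2
  refine .mono (.seq h1 (.seq h3 h2)) ?_
  simp only [List.flatMap_append, List.length_append]
  omega

/-- The clause without `u` is collected on `C` while the others return to `A`. After printing, the
unit and then the resolvent are pushed on `A`, which explains the order of the new list. The 28
printed items, at `19 * (N + 1)` steps each, dominate the bound. -/
theorem exec_resolveUnit {u : Lit} {p q : Clause} {L M : List Clause} {D : Deriv} {N : ℕ}
    (hN : (encodeClauses (L ++ (p ++ u :: q) :: M)).length ≤ N) :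
    Exec resolveUnit
      (st (q.flatMap encodeLit ++ .endClause :: encodeClauses M)
        ((p.flatMap encodeLit).reverse ++ (encodeBody L).reverse) [] (encodeLit u) [] []
        (encodeDeriv D))
      (st (encodeClauses ((p ++ q) :: [u.dual] :: (L ++ M))) [] [] [] [] []
        (encodeDeriv (resDeriv u (p ++ q) (L ++ M) D))) (700 * (N + 1)) := by
  have hlen : (encodeClauses (L ++ (p ++ u :: q) :: M)).length =
      (encodeClauses (L ++ M)).length + ((p ++ q).flatMap encodeLit).length +
        (encodeLit u).length + 1 := by
    simp only [encodeClauses_eq, encodeBody_append, encodeBody_cons, List.flatMap_append,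
      List.flatMap_cons, List.length_append, List.length_cons, List.length_nil]
    omega
  have e1 : (encodeBody L).length ≤ (encodeClauses (L ++ M)).length := by
    simp [encodeClauses_eq, encodeBody_append]
  set F := encodeDeriv (resDeriv u (p ++ q) (L ++ M) D) with hF
  set c := (p ++ q).flatMap encodeLit ++ [Sym.endClause] with hc
  have hcl : c.length = ((p ++ q).flatMap encodeLit).length + 1 := by
    rw [hc, List.length_append]
    rfl
  have h1 := exec_gather p q L (encodeClauses M) (encodeLit u) (encodeDeriv D)
  have h2 := exec_move_all (k := Stk.B) (j := .A) (by decide)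
    (st (encodeClauses M) (encodeBody L).reverse c (encodeLit u) [] [] (encodeDeriv D))
  have h3 := exec_print resItems
    (st (encodeClauses (L ++ M)) [] c (encodeLit u) [] [] (encodeDeriv D)) N
    (by
      have h5 : (encodeClauses (L ++ M)).length ≤ N := by omega
      have h6 : (encodeLit u).length ≤ N := by omega
      have h7 : c.length ≤ N := by omega
      simp [resItems, ItemOk, length_subDisj, length_subConj, length_subDual, h5, h6, h7]) rfl rfl
  have h4 := exec_push_A (encodeClauses (L ++ M)) [] c (encodeLit u) [] [] F .endClause
  have h5 := exec_emit (k := .U) (j := .A) (by decide) (by decide) (by decide) (by decide)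
    (by decide) length_subDual
    (st (.endClause :: encodeClauses (L ++ M)) [] c (encodeLit u) [] [] F) rfl rfl
  have h6 := exec_emit (k := .C) (j := .A) (g := fun x => [x]) (by decide) (by decide) (by decide)
    (by decide) (by decide) (fun _ => by simp)
    (st (encodeLit u.dual ++ .endClause :: encodeClauses (L ++ M)) [] c (encodeLit u) [] [] F)
    rfl rfl
  have h7 := exec_clear .U (st (encodeClauses ((p ++ q) :: [u.dual] :: (L ++ M))) []
    c (encodeLit u) [] [] F)
  have h8 := exec_clear .C (st (encodeClauses ((p ++ q) :: [u.dual] :: (L ++ M))) []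
    c [] [] [] F)
  have e2 : (encodeBody L).reverse.reverse ++ encodeClauses M = encodeClauses (L ++ M) := by
    simp [encodeClauses_eq, encodeBody_append]
  have e3 : resItems.flatMap (itemStr
      (st (encodeClauses (L ++ M)) [] c (encodeLit u) [] [] (encodeDeriv D))) ++ encodeDeriv D =
      F := by
    simp [itemStr, resItems, resDeriv, encodeDeriv, encodeFormula, ← flatMap_subDisj,
      ← flatMap_subConj, flatMap_subDual, hF, hc]
  have e4 : c.flatMap (fun x => [x]) ++ (encodeLit u.dual ++ .endClause ::
      encodeClauses (L ++ M)) = encodeClauses ((p ++ q) :: [u.dual] :: (L ++ M)) := by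
    simp [encodeClauses_eq, encodeBody_cons, hc]
  rw [update_st_B, update_st_A, st_B, st_A, e2, List.length_reverse] at h2
  rw [update_st_O, st_O, e3] at h3
  rw [update_st_A, st_U, st_A, flatMap_subDual] at h5
  rw [update_st_A, st_C, st_A, e4] at h6
  rw [update_st_U, st_U] at h7
  rw [update_st_C, st_C] at h8
  rw [show resItems.length = 28 from rfl] at h3
  refine .mono (.seq h1 (.seq h2 (.seq h3 (.seq h4 (.seq h5 (.seq h6 (.seq h7 h8))))))) ?_
  omega

end KSSim

/-! ### The scan for unit clauses and the complete program. -/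

namespace KSSim

open Function Prog

namespace Prog

/-- The body of the loop that moves a literal from `B` to `U` and dualizes it. -/
def takeBody : Option Sym → Prog Stk Sym
  | some (.sign b) => .push .U (.sign !b)
  | some x => .push .U x
  | none => .skip

/-- Use the unit clause whose literal is on `B`. -/
def useUnit : Prog Stk Sym :=
  .seq (.loop .B takeBody fun x => x.elim false notSign)
    (.seq (.move .B .A fun _ => false) (findLit resolveUnit dropUnit))

/-- The part of `scanBody` that follows the first literal of a clause. -/
def scanNext : Option Sym → Prog Stk Sym
  | some .endClause => useUnit
  | some (.sign b) => .seq (.push .B (.sign b)) (.move .A .B fun x => x == .endClause)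
  | _ => .skip

/-- The body of the loop that searches unit clauses and uses them. -/
def scanBody : Option Sym → Prog Stk Sym
  | some .endClause => .push .B .endClause
  | some (.sign b) => .seq (.push .B (.sign b))
      (.seq (.move .A .B fun x => x == .endLit) (.pop .A scanNext))
  | _ => .skip

/-- The loop that searches unit clauses goes on for this symbol of `A`. -/
def scanCont : Option Sym → Bool
  | some .endClause => true
  | some (.sign _) => true
  | _ => false

/-- Unit propagation for the clauses on `A`. -/
def scan : Prog Stk Sym := .loop .A scanBody scanCont

/-- Read the first of the two lists of clauses on `A`, and drop the other one. -/
def readInput : Prog Stk Sym :=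
  .seq (.move .A .B fun x => x == .endList) (.seq (.clear .A) (.move .B .A fun _ => false))

/-- The items of the string of `unitDeriv` that precede the derivation found by `unitProp`. -/
def finalItems : List (List Sym ⊕ Stk × (Sym → List Sym)) :=
  [.inl [.rule .eq, .fm, .top, .rule .eq, .or], .inr (.A, subWeak)]

/-- The program that computes `unitDeriv`. -/
def unitProg : Prog Stk Sym :=
  .seq readInput (.seq (.trans .A .O dualTrans dualFin) (.seq (.push .O .fm) (.seq scan
    (.seq (.push .A .endList) (.seq (.move .B .A fun _ => false)
      (.seq (.print finalItems) (.clear .A)))))))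

end Prog

theorem exec_take_loop {a b c u p o w : List Sym} {s : Bool} (hw : ∀ x ∈ w, notSign x = true) :
    Exec (.loop .B takeBody fun x => x.elim false notSign)
      (st a (w ++ .sign s :: b) c u [] p o) (st a b c (.sign (!s) :: (w.reverse ++ u)) [] p o)
      (2 * w.length + 2) := by
  induction w generalizing u with
  | nil =>
    refine .loop_cons_exit (x := .sign s) (w := b) rfl rfl ?_
    rw [update_st_B]
    exact exec_push_U ..
  | cons x w ih =>
    have h := ih (u := x :: u) fun y hy => hw y (List.mem_cons_of_mem _ hy)
    have hx := hw x List.mem_cons_self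
    have e : takeBody (some x) = .push .U x := by
      cases x <;> first | rfl | simp [notSign] at hx
    refine Exec.congr (.loop_cons (m := 1) (x := x) (w := w ++ .sign s :: b) rfl hx ?_ h) ?_ ?_
    · rw [e, update_st_B]
      exact exec_push_U ..
    · simp
    · rw [List.length_cons]
      omega

theorem exec_take (x : Lit) (a b c p o : List Sym) :
    Exec (.loop .B takeBody fun x => x.elim false notSign)
      (st a ((encodeLit x).reverse ++ b) c [] [] p o) (st a b c (encodeLit x.dual) [] p o)
      (2 * (encodeLit x).length) := by
  obtain ⟨l, h1, h2⟩ := encodeLit_eq x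
  have h := exec_take_loop (a := a) (b := b) (c := c) (u := []) (p := p) (o := o) (s := x.pos)
    (w := (l.map Sym.bit ++ [Sym.endLit]).reverse)
    (fun y hy => notSign_of_mem_bits (List.mem_reverse.1 hy))
  have e : (l.map Sym.bit ++ [Sym.endLit]).reverse ++ .sign x.pos :: b =
      (encodeLit x).reverse ++ b := by simp [h1]
  rw [e, List.reverse_reverse, List.append_nil, ← h2, List.length_reverse] at h
  refine h.mono ?_
  rw [h1, List.length_cons]
  omega

theorem length_encodeClauses_insert (L M : List Clause) (c : Clause) :
    (encodeClauses (L ++ c :: M)).length =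
      (encodeClauses (L ++ M)).length + (c.flatMap encodeLit).length + 1 := by
  simp only [encodeClauses_eq, encodeBody_append, encodeBody_cons, List.length_append,
    List.length_cons]
  omega

theorem length_encodeLit_dual (a : Lit) : (encodeLit a.dual).length = (encodeLit a).length := by
  obtain ⟨l, h1, h2⟩ := encodeLit_eq a
  rw [h1, h2]
  rfl

/-- The end marker of the unit has already been consumed, and its literal leaves `B` for `U`. Moving
`B` back to `A` thus yields the list without the unit, and the search covers the clauses on both
sides of it. -/
theorem exec_useUnit_aux {a : Lit} {L M : List Clause} {D : Deriv} {fin : Stk → List Sym} {n : ℕ}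
    (h : Exec (findLit resolveUnit dropUnit)
      (st (encodeClauses (L ++ M)) [] [] (encodeLit a.dual) [] [] (encodeDeriv D)) fin n) :
    Exec useUnit
      (st (encodeClauses M) ((encodeLit a).reverse ++ (encodeBody L).reverse) [] [] [] []
        (encodeDeriv D)) fin (n + 2 * (encodeLit a).length + 2 * (encodeBody L).length + 2) := by
  have h1 := exec_take a (encodeClauses M) (encodeBody L).reverse [] [] (encodeDeriv D)
  have h2 := exec_move_all (k := Stk.B) (j := .A) (by decide)
    (st (encodeClauses M) (encodeBody L).reverse [] (encodeLit a.dual) [] [] (encodeDeriv D))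
  have e : (encodeBody L).reverse.reverse ++ encodeClauses M = encodeClauses (L ++ M) := by
    simp [encodeClauses_eq, encodeBody_append]
  rw [update_st_B, update_st_A, st_B, st_A, e, List.length_reverse] at h2
  refine .mono (.seq h1 (.seq h2 h)) ?_
  omega

theorem exec_useUnit_drop {a : Lit} {L M : List Clause} {D : Deriv} {N : ℕ}
    (hN : (encodeClauses (L ++ [a] :: M)).length ≤ N) (h : extractLit a.dual (L ++ M) = none) :
    Exec useUnit
      (st (encodeClauses M) ((encodeLit a).reverse ++ (encodeBody L).reverse) [] [] [] []
        (encodeDeriv D))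
      (st (encodeClauses (L ++ M)) [] [] [] [] []
        (encodeDeriv (dropDeriv a.dual (L ++ M) D))) (800 * (N + 1)) := by
  have e1 := length_encodeClauses_insert L M [a]
  have e2 := length_encodeLit_dual a
  have e3 : (encodeBody (L ++ M)).length + 1 = (encodeClauses (L ++ M)).length := by
    simp [encodeClauses_eq]
  have e4 : (encodeBody L).length ≤ (encodeBody (L ++ M)).length := by
    simp [encodeBody_append]
  rw [List.flatMap_singleton] at e1
  have h1 := exec_dropUnit (u := a.dual) (L := L ++ M) (D := D) (N := N) (by omega) (by omega)
  have h2 := exec_findLit_missing (found := resolveUnit) h1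
  have h3 := exec_findLit_body (v := [.endList]) (b := []) (extractLit_none h)
    (by rwa [List.append_nil])
  refine .mono (exec_useUnit_aux h3) ?_
  omega

theorem exec_useUnit_res {a : Lit} {L M X : List Clause} {c : Clause} {D : Deriv} {N : ℕ}
    (hN : (encodeClauses (L ++ [a] :: M)).length ≤ N)
    (h : extractLit a.dual (L ++ M) = some (c, X)) :
    Exec useUnit
      (st (encodeClauses M) ((encodeLit a).reverse ++ (encodeBody L).reverse) [] [] [] []
        (encodeDeriv D))
      (st (encodeClauses (c :: [a] :: X)) [] [] [] [] []
        (encodeDeriv (resDeriv a.dual c X D))) (800 * (N + 1)) := by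
  have e1 := length_encodeClauses_insert L M [a]
  have e2 := length_encodeLit_dual a
  have e3 : (encodeBody (L ++ M)).length + 1 = (encodeClauses (L ++ M)).length := by
    simp [encodeClauses_eq]
  have e4 : (encodeBody L).length ≤ (encodeBody (L ++ M)).length := by
    simp [encodeBody_append]
  rw [List.flatMap_singleton] at e1
  obtain ⟨L₁, p, q, L₂, hL, rfl, rfl, hp, hL₁⟩ := extractLit_some h
  have h1 := exec_resolveUnit (u := a.dual) (p := p) (q := q) (L := L₁) (M := L₂) (D := D)
    (N := N) (by rw [← hL]; omega)
  rw [Lit.dual_dual] at h1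
  have h2 := exec_findLit_eq (missing := dropUnit) h1
  have h3 := exec_findLit_lits (d := p) hp h2
  have h4 := exec_findLit_body (b := []) hL₁ (by rwa [List.append_nil])
  have e5 : encodeBody L₁ ++ (p.flatMap encodeLit ++ (encodeLit a.dual ++
      (q.flatMap encodeLit ++ .endClause :: encodeClauses L₂))) = encodeClauses (L ++ M) := by
    rw [hL]
    simp [encodeClauses_eq, encodeBody_append, encodeBody_cons]
  have e6 := congrArg List.length e5
  simp only [List.length_append] at e6
  rw [e5] at h4
  refine .mono (exec_useUnit_aux h4) ?_
  omega

theorem bit_ne_endLit (l : List Bool) : ∀ y ∈ l.map Sym.bit, (y == Sym.endLit) = false := by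
  intro y hy
  obtain ⟨b, -, rfl⟩ := List.mem_map.1 hy
  rfl

/-- The symbol after the first literal decides: an end marker of the clause means a unit, a sign
means at least two literals. -/
theorem exec_scan_skip {d : Clause} {v b o : List Sym} {fin : Stk → List Sym} {n : ℕ}
    (hd : d.length ≠ 1)
    (h : Exec scan (st v (.endClause :: ((d.flatMap encodeLit).reverse ++ b)) [] [] [] [] o)
      fin n) :
    Exec scan (st (d.flatMap encodeLit ++ .endClause :: v) b [] [] [] [] o) fin
      (n + 10 * ((d.flatMap encodeLit).length + 1)) := by
  match d, hd with
  | [], _ =>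
    refine .mono (.loop_cons (m := 1) (x := .endClause) (w := v) rfl rfl ?_ h) ?_
    · rw [update_st_A]
      exact exec_push_B ..
    · simp only [List.flatMap_nil, List.length_nil]
      omega
  | x :: y :: d, _ =>
    obtain ⟨l, hx, -⟩ := encodeLit_eq x
    obtain ⟨r, hr⟩ : ∃ r, r = (encodeLit y).tail ++ d.flatMap encodeLit := ⟨_, rfl⟩
    have hy : (y :: d).flatMap encodeLit = .sign y.pos :: r := by
      rw [hr, List.flatMap_cons]
      rfl
    have e : (x :: y :: d).flatMap encodeLit =
        .sign x.pos :: (l.map Sym.bit ++ .endLit :: .sign y.pos :: r) := by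
      rw [List.flatMap_cons, hy, hx]
      simp
    have hr' : ∀ z ∈ r, (z == Sym.endClause) = false := by
      intro z hz
      have := ne_endClause_of_mem (c := y :: d) (x := z) (by rw [hy]; simp [hz])
      simpa using this
    rw [e] at h ⊢
    have h1 := exec_move (k := Stk.A) (j := .B) (by decide) (halt := fun x => x == .endLit)
      (s := st (l.map Sym.bit ++ .endLit :: (.sign y.pos :: (r ++ .endClause :: v)))
        (.sign x.pos :: b) [] [] [] [] o) rfl (bit_ne_endLit l) (by simp)
    rw [update_st_A, update_st_B, st_B] at h1
    have h2 := exec_move (k := Stk.A) (j := .B) (by decide) (halt := fun x => x == .endClause)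
      (s := st (r ++ .endClause :: v) (.sign y.pos :: .endLit ::
        ((l.map Sym.bit).reverse ++ .sign x.pos :: b)) [] [] [] [] o) rfl hr' (by simp)
    rw [update_st_A, update_st_B, st_B] at h2
    have e2 : Sym.endClause :: (r.reverse ++ .sign y.pos :: .endLit ::
        ((l.map Sym.bit).reverse ++ .sign x.pos :: b)) = .endClause ::
        ((Sym.sign x.pos :: (l.map Sym.bit ++ .endLit :: .sign y.pos :: r)).reverse ++ b) := by
      simp
    rw [e2] at h2
    have h3 : Exec (.pop .A scanNext) (st (.sign y.pos :: (r ++ .endClause :: v))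
        (.endLit :: ((l.map Sym.bit).reverse ++ .sign x.pos :: b)) [] [] [] [] o)
        (st v (.endClause :: ((Sym.sign x.pos :: (l.map Sym.bit ++ .endLit :: .sign y.pos ::
          r)).reverse ++ b)) [] [] [] [] o) (1 + (2 * r.length + 2) + 1) := by
      refine .pop rfl rfl ?_
      rw [update_st_A]
      exact .seq (exec_push_B ..) h2
    refine .mono (.loop_cons (m := 1 + (2 * l.length + 2 + (1 + (2 * r.length + 2) + 1)))
      (x := .sign x.pos)
      (w := l.map Sym.bit ++ .endLit :: (.sign y.pos :: (r ++ .endClause :: v))) ?_ rfl ?_ h) ?_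
    · simp
    · rw [update_st_A]
      refine .seq (exec_push_B ..) (.seq ?_ h3)
      simpa using h1
    · simp only [List.length_cons, List.length_append, List.length_map]
      omega

theorem exec_scan_body {L : List Clause} {v b o : List Sym} {fin : Stk → List Sym} {n : ℕ}
    (hL : ∀ d ∈ L, d.length ≠ 1)
    (h : Exec scan (st v ((encodeBody L).reverse ++ b) [] [] [] [] o) fin n) :
    Exec scan (st (encodeBody L ++ v) b [] [] [] [] o) fin (n + 10 * (encodeBody L).length) := by
  induction L generalizing b with
  | nil => exact h
  | cons d L ih =>
    rw [encodeBody_cons] at h ⊢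
    have h1 := ih (b := .endClause :: ((d.flatMap encodeLit).reverse ++ b))
      (fun e he => hL e (List.mem_cons_of_mem _ he)) (by simpa using h)
    have h2 := exec_scan_skip (hL d List.mem_cons_self) h1
    rw [List.append_assoc, List.cons_append]
    refine .mono h2 ?_
    simp only [List.length_append, List.length_cons]
    omega

theorem exec_scan_unit {a : Lit} {v b o : List Sym} {s fin : Stk → List Sym} {m n : ℕ}
    (hu : Exec useUnit (st v ((encodeLit a).reverse ++ b) [] [] [] [] o) s m)
    (h : Exec scan s fin n) :
    Exec scan (st (encodeLit a ++ .endClause :: v) b [] [] [] [] o) fin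
      (m + n + 2 * (encodeLit a).length + 5) := by
  obtain ⟨l, ha, -⟩ := encodeLit_eq a
  have h1 := exec_move (k := Stk.A) (j := .B) (by decide) (halt := fun x => x == .endLit)
    (s := st (l.map Sym.bit ++ .endLit :: .endClause :: v)
      (.sign a.pos :: b) [] [] [] [] o) rfl (bit_ne_endLit l) (by simp)
  have e : Sym.endLit :: ((l.map Sym.bit).reverse ++ .sign a.pos :: b) =
      (encodeLit a).reverse ++ b := by simp [ha]
  rw [update_st_A, update_st_B, st_B, e] at h1
  have h2 : Exec (.pop .A scanNext) (st (.endClause :: v) ((encodeLit a).reverse ++ b) [] [] [] []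
      o) s (m + 1) := by
    refine .pop rfl rfl ?_
    rw [update_st_A]
    exact hu
  refine .mono (.loop_cons (m := 1 + (2 * (l.map Sym.bit).length + 2 + (m + 1))) (x := .sign a.pos)
    (w := l.map Sym.bit ++ .endLit :: .endClause :: v) ?_ rfl ?_ h) ?_
  · simp [ha]
  · rw [update_st_A]
    exact .seq (exec_push_B ..) (.seq h1 h2)
  · simp only [ha, List.length_cons, List.length_append, List.length_map]
    omega

/-- Using a unit leaves a complete list on `A` and empties the other working stacks, so the loop
restarts as the recursive call of `unitProp`. The encoded list never grows, so one `N` bounds every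
round. -/
theorem exec_scan (L : List Clause) (D : Deriv) (N : ℕ) (hN : (encodeClauses L).length ≤ N) :
    Exec scan (st (encodeClauses L) [] [] [] [] [] (encodeDeriv D))
      (st [] (encodeBody (unitProp L D).1).reverse [] [] [] [] (encodeDeriv (unitProp L D).2))
      ((L.flatten.length + 1) * (900 * (N + 1))) ∧
    (encodeClauses (unitProp L D).1).length ≤ N := by
  fun_induction unitProp L D with
  | case1 L D h =>
    refine ⟨?_, hN⟩
    have h1 : Exec scan (st [.endList] ((encodeBody L).reverse ++ []) [] [] [] [] (encodeDeriv D))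
        (st [] (encodeBody L).reverse [] [] [] [] (encodeDeriv D)) 2 := by
      refine .loop_cons_exit (m := 1) (x := .endList) (w := []) rfl rfl ?_
      rw [update_st_A, List.append_nil]
      exact .skip _
    refine .mono (exec_scan_body (extractUnit_none h) h1) ?_
    rw [encodeClauses_eq, List.length_append, List.length_singleton] at hN
    rw [Nat.add_mul]
    omega
  | case2 L D a L₁ h h' ih =>
    obtain ⟨M₁, M₂, rfl, rfl, hM⟩ := extractUnit_some h
    have e1 := length_encodeClauses_insert M₁ M₂ [a]
    rw [List.flatMap_singleton] at e1
    obtain ⟨h1, h2⟩ := ih (by omega)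
    refine ⟨?_, h2⟩
    have h3 := exec_scan_body (b := []) hM (by
      rw [List.append_nil]
      exact exec_scan_unit (exec_useUnit_drop (D := D) hN h') h1)
    have e2 : encodeBody M₁ ++ (encodeLit a ++ .endClause :: encodeClauses M₂) =
        encodeClauses (M₁ ++ [a] :: M₂) := by
      simp [encodeClauses_eq, encodeBody_append, encodeBody_cons]
    have e3 := congrArg List.length e2
    simp only [List.length_append] at e3
    have e4 : (M₁ ++ [a] :: M₂).flatten.length = (M₁ ++ M₂).flatten.length + 1 := by
      simp only [List.flatten_append, List.flatten_cons, List.length_append, List.length_cons,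
        List.length_nil]
      omega
    rw [e2] at h3
    refine h3.mono ?_
    rw [e4]
    -- One round is split off the product, after which the inequality is linear in the remaining
    -- product.
    have e9 := fun K : ℕ => Nat.succ_mul (K + 1) (900 * (N + 1))
    generalize List.length (List.flatten _) = K
    specialize e9 K
    rw [Nat.succ_eq_add_one] at e9
    omega
  | case3 L D a L₁ h c X h' ih =>
    obtain ⟨M₁, M₂, rfl, rfl, hM⟩ := extractUnit_some h
    obtain ⟨N₁, p, q, N₂, hX, rfl, rfl, -, -⟩ := extractLit_some h'
    have e1 := length_encodeClauses_insert M₁ M₂ [a]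
    have e5 := length_encodeClauses_insert N₁ N₂ (p ++ a.dual :: q)
    have e6 := length_encodeClauses_insert [] ([a] :: (N₁ ++ N₂)) (p ++ q)
    have e7 := length_encodeClauses_insert [] (N₁ ++ N₂) [a]
    rw [← hX] at e5
    simp only [List.nil_append, List.flatMap_append, List.flatMap_cons, List.length_append,
      List.flatMap_nil, List.append_nil] at e1 e5 e6 e7
    obtain ⟨h1, h2⟩ := ih (by omega)
    refine ⟨?_, h2⟩
    have h3 := exec_scan_body (b := []) hM (by
      rw [List.append_nil]
      exact exec_scan_unit (exec_useUnit_res (D := D) hN h') h1)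
    have e2 : encodeBody M₁ ++ (encodeLit a ++ .endClause :: encodeClauses M₂) =
        encodeClauses (M₁ ++ [a] :: M₂) := by
      simp [encodeClauses_eq, encodeBody_append, encodeBody_cons]
    have e3 := congrArg List.length e2
    simp only [List.length_append] at e3
    have e4 : (M₁ ++ [a] :: M₂).flatten.length =
        ((p ++ q) :: [a] :: (N₁ ++ N₂)).flatten.length + 1 := by
      have e8 := congrArg (fun l => l.flatten.length) hX
      simp only [List.flatten_append, List.flatten_cons, List.length_append, List.length_cons,
        List.length_nil] at e8 ⊢
      omega
    rw [e2] at h3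
    refine h3.mono ?_
    rw [e4]
    have e9 := fun K : ℕ => Nat.succ_mul (K + 1) (900 * (N + 1))
    generalize List.length (List.flatten _) = K
    specialize e9 K
    rw [Nat.succ_eq_add_one] at e9
    omega

/-- The refutation is erased here: the output depends on the clauses only. -/
theorem exec_readInput (x : List Clause × List Clause) :
    Exec readInput (st (encodeInput x) [] [] [] [] [] [])
      (st (encodeClauses x.1) [] [] [] [] [] []) (4 * (encodeInput x).length + 6) := by
  have hne : ∀ y ∈ encodeBody x.1, (y == Sym.endList) = false := by
    intro y hy
    obtain ⟨c, -, h⟩ := List.mem_flatMap.1 hy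
    simp only [List.mem_append, List.mem_flatMap, encodeLit, List.mem_cons,
      List.mem_map, List.not_mem_nil, or_false] at h
    rcases h with ⟨a, -, rfl | ⟨b, -, rfl⟩ | rfl⟩ | rfl <;> simp
  have e : encodeInput x = encodeBody x.1 ++ .endList :: encodeClauses x.2 := by
    simp [encodeInput, encodeClauses_eq]
  have h1 := exec_move (k := Stk.A) (j := .B) (by decide) (halt := fun x => x == .endList)
    (s := st (encodeInput x) [] [] [] [] [] []) e hne (by simp)
  have h2 := exec_clear .A
    (st (encodeClauses x.2) (.endList :: (encodeBody x.1).reverse) [] [] [] [] [])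
  have h3 := exec_move_all (k := Stk.B) (j := .A) (by decide)
    (st [] (.endList :: (encodeBody x.1).reverse) [] [] [] [] [])
  have e1 : (Sym.endList :: (encodeBody x.1).reverse).reverse ++ [] = encodeClauses x.1 := by
    simp [encodeClauses_eq]
  rw [update_st_A, update_st_B, st_B, List.append_nil] at h1
  rw [update_st_A, st_A] at h2
  rw [update_st_B, update_st_A, st_B, st_A, e1] at h3
  refine .mono (.seq h1 (.seq h2 h3)) ?_
  rw [e]
  simp only [List.length_append, List.length_cons, List.length_reverse]
  omega

/-- Bounds the number of rounds of propagation by the length of the input. -/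
theorem length_flatten_le (L : List Clause) : L.flatten.length ≤ (encodeClauses L).length := by
  have h : ∀ c : Clause, c.length ≤ (c.flatMap encodeLit).length := by
    intro c
    induction c with
    | nil => exact le_rfl
    | cons a c ih =>
      obtain ⟨l, ha, -⟩ := encodeLit_eq a
      rw [List.flatMap_cons, ha]
      simp only [List.length_append, List.length_cons]
      omega
  induction L with
  | nil => exact Nat.zero_le _
  | cons c L ih =>
    have := h c
    simp only [encodeClauses_eq, encodeBody_cons, List.flatten_cons, List.length_append,
      List.length_cons] at ih ⊢
    omega

theorem exec_unitProg (x : List Clause × List Clause) :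
    Exec unitProg (st (encodeInput x) [] [] [] [] [] [])
      (st [] [] [] [] [] [] (encodeDeriv (unitDeriv x.1)))
      (2000 * ((encodeInput x).length + 1) ^ 2) := by
  obtain ⟨Γ, π⟩ := x
  set N := (encodeInput (Γ, π)).length with hN
  have e1 : (encodeClauses Γ).length ≤ N := by simp [hN, encodeInput]
  have h1 := exec_readInput (Γ, π)
  have h2 := exec_trans (k := .A) (j := .O) (by decide) (by decide) (by decide) (by decide)
    (by decide) length_dualTrans length_dualFin (st (encodeClauses Γ) [] [] [] [] [] []) rfl rfl
  rw [st_A, st_O, (foldr_dualTrans Γ []).1, update_st_O, List.append_nil] at h2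
  have h3 := Exec.push .O Sym.fm
    (st (encodeClauses Γ) [] [] [] [] [] (encodeFormula (cnf Γ).dual))
  rw [update_st_O, st_O] at h3
  obtain ⟨h4, e2⟩ := exec_scan Γ (.fm (cnf Γ).dual) N e1
  have e3 := (length_flatten_le Γ).trans e1
  have e4 : (encodeDeriv (.fm (cnf Γ).dual)) = .fm :: encodeFormula (cnf Γ).dual := rfl
  rw [e4] at h4
  have e5 : unitDeriv Γ = .step .eq (.fm .top) (.step .eq
    (weakDeriv (unitProp Γ (.fm (cnf Γ).dual)).1) (unitProp Γ (.fm (cnf Γ).dual)).2) := rfl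
  rw [e5]
  generalize unitProp Γ (.fm (cnf Γ).dual) = r at h4 e2 ⊢
  obtain ⟨L, D⟩ := r
  have h5 := exec_push_A [] (encodeBody L).reverse [] [] [] [] (encodeDeriv D) .endList
  have h6 := exec_move_all (k := Stk.B) (j := .A) (by decide)
    (st [.endList] (encodeBody L).reverse [] [] [] [] (encodeDeriv D))
  have e6 : (encodeBody L).reverse.reverse ++ [.endList] = encodeClauses L := by
    rw [List.reverse_reverse]
    rfl
  rw [update_st_B, update_st_A, st_B, st_A, e6, List.length_reverse] at h6
  have hi : ∀ i ∈ finalItems,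
      ItemOk (st (encodeClauses L) [] [] [] [] [] (encodeDeriv D)) N i := by
    simp [finalItems, ItemOk, length_subWeak, e2]
  have h7 := exec_print finalItems (st (encodeClauses L) [] [] [] [] [] (encodeDeriv D)) N hi
    rfl rfl
  have e7 : finalItems.flatMap (itemStr
      (st (encodeClauses L) [] [] [] [] [] (encodeDeriv D))) ++ encodeDeriv D =
      encodeDeriv (.step .eq (.fm .top) (.step .eq (weakDeriv L) D)) := by
    simp [itemStr, finalItems, encodeDeriv, encodeFormula, ← flatMap_subWeak]
  rw [update_st_O, st_O, e7, show finalItems.length = 2 from rfl] at h7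
  have h8 := exec_clear .A (st (encodeClauses L) [] [] [] [] []
    (encodeDeriv (.step .eq (.fm .top) (.step .eq (weakDeriv L) D))))
  rw [update_st_A, st_A] at h8
  refine .mono (.seq h1 (.seq h2 (.seq h3 (.seq h4 (.seq h5 (.seq h6 (.seq h7 h8))))))) ?_
  have e8 : (encodeBody L).length ≤ (encodeClauses L).length := by simp [encodeClauses_eq]
  have e9 : (Γ.flatten.length + 1) * (900 * (N + 1)) ≤ (N + 1) * (900 * (N + 1)) :=
    Nat.mul_le_mul_right _ (by omega)
  have e10 : (N + 1) * (900 * (N + 1)) = 900 * (N + 1) ^ 2 := by ring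
  have e11 : N + 1 ≤ (N + 1) ^ 2 := Nat.le_self_pow (by decide) _
  dsimp only at e2
  omega

end KSSim

/-- Multiset Resolution lacks contraction: a resolvent is shorter than one of its premisses only if
the other premiss is a unit clause. Hence refutable clauses are refutable by unit propagation
(`nil_mem_unitProp`). The algorithm performs unit propagation on the clauses, resolving one literal
occurrence at a time, and writes the corresponding derivation. -/
theorem mainTheorem5 :
    ∃ f : List Clause × List Clause → Deriv,
      Nonempty (Turing.TM2ComputableInPolyTime encodeInput encodeDeriv f) ∧
      ∀ Γ π : List Clause, IsRefutation (toMultisets Γ) (toMultisets π) →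
        (f (Γ, π)).IsKSProof (cnf Γ).dual := by
  refine ⟨fun x => unitDeriv x.1, ?_, fun Γ π h => unitDeriv_isKSProof (nil_mem_unitProp _ h)⟩
  refine Prog.computableInPolyTime Prog.unitProg .A .O _ _ _
    (Polynomial.C 2000 * (Polynomial.X + 1) ^ 2) fun x => ?_
  have e1 : Function.update (fun _ => []) Stk.A (encodeInput x) =
      st (encodeInput x) [] [] [] [] [] [] := by
    funext k
    cases k <;> rfl
  have e2 : Function.update (fun _ => []) Stk.O (encodeDeriv (unitDeriv x.1)) =
      st [] [] [] [] [] [] (encodeDeriv (unitDeriv x.1)) := by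
    funext k
    cases k <;> rfl
  have h := exec_unitProg x
  rw [← e1, ← e2] at h
  simpa using h
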